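/- For positive integers $n_1,n_2,k_1,k_2$, let $$\mathcal M_{k_1,k_2}=\Big\{M\in\mathbb R^{n_1\times n_2}: M_{ij}=Q_{(z_1)_i (z_2)_j}\ \text{for some } Q\in\mathbb R^{k_1\times k_2},\ z_1\in[k_1]^{n_1},\ z_2\in[k_2]^{n_2}\Big\}.$$ For $M\in\mathcal M_{k_1,k_2}$ we observe $Y=M+E\in\mathbb R^{n_1\times n_2}$, where $E$ has i.i.d. $N(0,1)$ entries, and we measure the error of an estimator $\widehat M=\widehat M(Y)$ by $$\ell(\widehat M,M)=\frac1{n_1n_2}\sum_{i=1}^{n_1}\sum_{j=1}^{n_2}(\widehat M_{ij}-M_{ij})^2 .$$ Let $\mathbb R[Y]^{n_1\times n_2}_{\le D}$ be the set of estimators $\widehat M$ each of whose entries $\widehat M_{ij}$ is a real polynomial of degree at most $D$ in the entries of $Y$. There exists a universal constant $c>0$ such that for all integers $n_1,n_2\ge1$, all $k_1,k_2$ with $k_1\wedge k_2\ge 2$, and all integers $D\ge1$, $$\inf_{\widehat M\in\mathbb R[Y]^{n_1\times n_2}_{\le D}}\ \sup_{M\in\mathcal M_{k_1,k_2}}\mathbb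 E\big(\ell(\widehat M,M)\big)\ \ge\ \frac{c}{D^4}\left(\frac{k_1\wedge k_2}{n_1+n_2}\wedge\frac1{k_1\wedge k_2}\right).$$ -/

import Mathlib

open MeasureTheory ProbabilityTheory

noncomputable section

namespace Biclustering

/-- The class of `n₁ × n₂` real matrices with a biclustering structure: `M i j = Q (z₁ i) (z₂ j)`
for some `k₁ × k₂` matrix `Q` and some label vectors `z₁ ∈ [k₁]^{n₁}`, `z₂ ∈ [k₂]^{n₂}`. -/
def paramSpace (n₁ n₂ k₁ k₂ : ℕ) : Set (Matrix (Fin n₁) (Fin n₂) ℝ) :=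
  {M | ∃ (Q : Matrix (Fin k₁) (Fin k₂) ℝ) (z₁ : Fin n₁ → Fin k₁) (z₂ : Fin n₂ → Fin k₂),
    ∀ i j, M i j = Q (z₁ i) (z₂ j)}

/-- The law of the noise `E`: its `n₁ n₂` entries are i.i.d. standard Gaussian. -/
def noiseLaw (n₁ n₂ : ℕ) : Measure (Fin n₁ × Fin n₂ → ℝ) :=
  Measure.pi fun _ => gaussianReal 0 1

/-- The observation `Y = M + E`, with entries indexed by pairs `(i, j)`. -/
def observation {n₁ n₂ : ℕ} (M : Matrix (Fin n₁) (Fin n₂) ℝ) (E : Fin n₁ × Fin n₂ → ℝ) :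
    Fin n₁ × Fin n₂ → ℝ :=
  fun p => M p.1 p.2 + E p

/-- Matrix-valued estimators all of whose entries are polynomials of (total) degree at most `D`
in the entries of the observation. -/
def polyEstimators (n₁ n₂ D : ℕ) :
    Set (Matrix (Fin n₁) (Fin n₂) (MvPolynomial (Fin n₁ × Fin n₂) ℝ)) :=
  {F | ∀ i j, (F i j).totalDegree ≤ D}

/-- The value at the observation `Y` of the estimator with polynomial entries `F`. -/
def estimate {n₁ n₂ : ℕ} (F : Matrix (Fin n₁) (Fin n₂) (MvPolynomial (Fin n₁ × Fin n₂) ℝ))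
    (Y : Fin n₁ × Fin n₂ → ℝ) : Matrix (Fin n₁) (Fin n₂) ℝ :=
  fun i j => MvPolynomial.eval Y (F i j)

/-- The normalized squared Frobenius loss. -/
def loss {n₁ n₂ : ℕ} (A M : Matrix (Fin n₁) (Fin n₂) ℝ) : ℝ :=
  1 / ((n₁ : ℝ) * n₂) * ∑ i, ∑ j, (A i j - M i j) ^ 2

/-- The risk `𝔼 ℓ(M̂(Y), M)` for `Y = M + E`, as an extended nonnegative number. -/
def risk {n₁ n₂ : ℕ} (F : Matrix (Fin n₁) (Fin n₂) (MvPolynomial (Fin n₁ × Fin n₂) ℝ))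
    (M : Matrix (Fin n₁) (Fin n₂) ℝ) : ENNReal :=
  ∫⁻ E, ENNReal.ofReal (loss (estimate F (observation M E)) M) ∂(noiseLaw n₁ n₂)

/-- The minimax risk of polynomial estimators of degree at most `D` over the biclustering class.
It takes values in `[0, ∞]`, so that the supremum of an unbounded risk is `∞`. -/
def polyMinimaxRisk (n₁ n₂ k₁ k₂ D : ℕ) : ENNReal :=
  ⨅ F ∈ polyEstimators n₁ n₂ D, ⨆ M ∈ paramSpace n₁ n₂ k₁ k₂, risk F M

end Biclustering

end

/-! The supremum over the class is bounded below by an average over a planted prior. With `k = min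
k₁ k₂`, rows and columns receive independent uniform labels in `ZMod k`, and the entry `(i, j)`
equals `lam` if the two labels agree and `0` otherwise. It then suffices to bound, for each entry
`e₀`, the average error of one polynomial `f` of degree at most `D`.

Let `x` be the indicator of agreement at `e₀` and `F` the average of the translates of `f` over the
prior, a polynomial in the noise alone. The average error is `𝔼 f² - 2 lam 𝔼[x f] + lam² / k`.
Jensen gives `𝔼 F² ≤ 𝔼 f²` (`gaussE_mixtureShift_sq_le`). The correlation `𝔼[x f]` is the Gaussian
mean of a differential operator applied to `F`, whose symbol `κ` consists of the joint cumulants of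
`x` with the planted entries (`sum_planted_gaussE_shift`). Bessel's inequality for expected
derivatives and Cauchy-Schwarz then give `(𝔼[x f])² ≤ (∑ κ² / m!) 𝔼 F²` (`sq_sum_tupleSum_le`).

The sum of `κ² / m!` is at most `(3/2) k⁻²`. Cumulants vanish on edge multisets not connected to
`e₀` (`plantedCumulant_eq_zero`) and are otherwise controlled by moments (`abs_plantedCumulant_le`).
A connected multiset grows edge by edge: an edge between old vertices has few choices, while one
with a new vertex has about `n₁ + n₂` choices per old vertex but costs `k⁻²` in the squared moment
(`connectedSum_le`). For `lam²` a small multiple of `D⁻⁴ min(k² / (n₁ + n₂), 1)` the levels form a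
geometric series. An AM-GM step leaves an error of at least `lam² / (4k)`. -/

namespace Biclustering

open MvPolynomial

/-! ### Gaussian moments, expectation of polynomials and integration by parts -/

section GaussianMoments

lemma integrable_pow_gaussianReal (n : ℕ) :
    Integrable (fun x : ℝ => x ^ n) (gaussianReal 0 1) := by
  have h := (memLp_id_gaussianReal (μ := 0) (v := 1) n).integrable_norm_pow'
  have h2 : Integrable (fun x : ℝ => ‖x ^ n‖) (gaussianReal 0 1) := by
    simpa [norm_pow] using h
  exact (integrable_norm_iff (by fun_prop)).1 h2

lemma integrable_pow_mul_gaussianPDFReal (n : ℕ) :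
    Integrable (fun x : ℝ => gaussianPDFReal 0 1 x * x ^ n) := by
  have h := integrable_pow_gaussianReal n
  rw [gaussianReal_of_var_ne_zero 0 one_ne_zero,
    integrable_withDensity_iff_integrable_smul' (measurable_gaussianPDF 0 1)
      (ae_of_all _ fun x => by simp [gaussianPDF])] at h
  refine h.congr (ae_of_all _ fun x => ?_)
  simp [gaussianPDF, ENNReal.toReal_ofReal (gaussianPDFReal_nonneg 0 1 x)]

lemma hasDerivAt_gaussianPDFReal (x : ℝ) :
    HasDerivAt (gaussianPDFReal 0 1) (-x * gaussianPDFReal 0 1 x) x := by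
  have h : HasDerivAt (fun y : ℝ => -(y - 0) ^ 2 / (2 * ((1 : NNReal) : ℝ))) (-x) x := by
    have := ((((hasDerivAt_id x).sub_const 0).pow 2).neg).div_const (2 * ((1 : NNReal) : ℝ))
    refine this.congr_deriv ?_
    simp
    ring
  have h2 := (h.exp).const_mul (√(2 * Real.pi * ((1 : NNReal) : ℝ)))⁻¹
  rw [gaussianPDFReal_def]
  refine h2.congr_deriv ?_
  ring

/-- Stein's identity for monomials. -/
lemma integral_pow_succ_gaussianReal (n : ℕ) :
    ∫ x, x ^ (n + 1) ∂(gaussianReal 0 1) = n * ∫ x, x ^ (n - 1) ∂(gaussianReal 0 1) := by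
  simp only [integral_gaussianReal_eq_integral_smul (one_ne_zero : (1 : NNReal) ≠ 0), smul_eq_mul]
  have hd : ∀ x : ℝ, HasDerivAt (fun x => gaussianPDFReal 0 1 x * x ^ n)
      (n * (gaussianPDFReal 0 1 x * x ^ (n - 1)) - gaussianPDFReal 0 1 x * x ^ (n + 1)) x := by
    intro x
    refine ((hasDerivAt_gaussianPDFReal x).mul (hasDerivAt_pow n x)).congr_deriv ?_
    ring
  have h := integral_eq_zero_of_hasDerivAt_of_integrable hd
    (((integrable_pow_mul_gaussianPDFReal _).const_mul _).sub
      (integrable_pow_mul_gaussianPDFReal _)) (integrable_pow_mul_gaussianPDFReal n)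
  rw [integral_sub ((integrable_pow_mul_gaussianPDFReal _).const_mul _)
      (integrable_pow_mul_gaussianPDFReal _), integral_const_mul] at h
  linarith

end GaussianMoments

section GaussianExpectation

variable {σ : Type*} [Fintype σ]

lemma eval_monomial_eq_prod (s : σ →₀ ℕ) (a : ℝ) (z : σ → ℝ) :
    eval z (monomial s a) = a * ∏ i, z i ^ s i := by
  rw [eval_monomial, Finsupp.prod_fintype _ _ (fun _ => pow_zero _)]

lemma integrable_eval (F : MvPolynomial σ ℝ) :
    Integrable (fun z => eval z F) (Measure.pi fun _ : σ => gaussianReal 0 1) := by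
  induction F using MvPolynomial.induction_on' with
  | monomial s a =>
    simp only [eval_monomial_eq_prod]
    exact (Integrable.fintype_prod (f := fun i (x : ℝ) => x ^ s i)
      fun i => integrable_pow_gaussianReal _).const_mul a
  | add p q hp hq =>
    simp only [map_add]
    exact hp.add hq

/-- Expectation of a polynomial in independent standard Gaussian variables. -/
noncomputable def gaussE : MvPolynomial σ ℝ →ₗ[ℝ] ℝ where
  toFun F := ∫ z, eval z F ∂(Measure.pi fun _ : σ => gaussianReal 0 1)
  map_add' F G := by
    simp only [map_add]
    exact integral_add (integrable_eval F) (integrable_eval G)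
  map_smul' c F := by
    simp only [smul_eval, RingHom.id_apply, smul_eq_mul]
    exact integral_const_mul c _

lemma gaussE_apply (F : MvPolynomial σ ℝ) :
    gaussE F = ∫ z, eval z F ∂(Measure.pi fun _ : σ => gaussianReal 0 1) := rfl

lemma gaussE_C (c : ℝ) : gaussE (C c : MvPolynomial σ ℝ) = c := by
  simp [gaussE_apply]

lemma gaussE_monomial (s : σ →₀ ℕ) (a : ℝ) :
    gaussE (monomial s a) = a * ∏ i, ∫ x, x ^ s i ∂(gaussianReal 0 1) := by
  simp only [gaussE_apply, eval_monomial_eq_prod]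
  rw [integral_const_mul, integral_fintype_prod_eq_prod (f := fun i (x : ℝ) => x ^ s i)]

/-- Gaussian integration by parts: on a monomial only the factor in the variable `i` changes, and
there it is the one-dimensional Stein identity. -/
lemma gaussE_X_mul [DecidableEq σ] (i : σ) (F : MvPolynomial σ ℝ) :
    gaussE (X i * F) = gaussE (pderiv i F) := by
  induction F using MvPolynomial.induction_on' with
  | monomial s a =>
    have hX : (X i : MvPolynomial σ ℝ) * monomial s a = monomial (Finsupp.single i 1 + s) a := by
      rw [X, monomial_mul, one_mul]
    rw [hX, pderiv_monomial, gaussE_monomial, gaussE_monomial,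
      ← Finset.mul_prod_erase _ _ (Finset.mem_univ i),
      ← Finset.mul_prod_erase (Finset.univ : Finset σ)
        (fun j => ∫ x, x ^ ((s - Finsupp.single i 1 : σ →₀ ℕ) j) ∂(gaussianReal 0 1))
        (Finset.mem_univ i)]
    have h1 : ∏ j ∈ Finset.univ.erase i, ∫ x, x ^ ((Finsupp.single i 1 + s : σ →₀ ℕ) j) ∂(gaussianReal 0 1)
        = ∏ j ∈ Finset.univ.erase i,
          ∫ x, x ^ ((s - Finsupp.single i 1 : σ →₀ ℕ) j) ∂(gaussianReal 0 1) := by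
      refine Finset.prod_congr rfl fun j hj => ?_
      have : j ≠ i := Finset.ne_of_mem_erase hj
      simp [this.symm]
    rw [h1]
    have h2 := integral_pow_succ_gaussianReal (s i)
    simp only [Finsupp.add_apply, Finsupp.single_eq_same, Finsupp.tsub_apply, add_comm 1 (s i)]
    rw [h2]
    ring
  | add p q hp hq => rw [mul_add, map_add, map_add, map_add, hp, hq]

lemma gaussE_sq_nonneg (F : MvPolynomial σ ℝ) : 0 ≤ gaussE (F * F) := by
  rw [gaussE_apply]
  refine integral_nonneg fun z => ?_
  simp only [map_mul]
  exact mul_self_nonneg _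

end GaussianExpectation

/-! ### Sums over lists of variables and Bessel's inequality for expected derivatives -/

section TupleSums

variable {σ : Type*} [Fintype σ] {M : Type*} [AddCommMonoid M]

/-- Sum of a function of lists over all lists of length `m` with entries in a finite type. -/
def tupleSum (m : ℕ) (a : List σ → M) : M := ∑ t : Fin m → σ, a (List.ofFn t)

lemma tupleSum_zero (a : List σ → M) : tupleSum 0 a = a [] := by
  simp [tupleSum]

lemma tupleSum_succ (m : ℕ) (a : List σ → M) :
    tupleSum (m + 1) a = ∑ j, tupleSum m fun l => a (j :: l) := by
  unfold tupleSum
  rw [← (Fin.consEquiv fun _ : Fin (m + 1) => σ).sum_comp, Fintype.sum_prod_type]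
  simp [Fin.consEquiv, List.ofFn_succ]

lemma tupleSum_add (m : ℕ) (a b : List σ → M) :
    tupleSum m (fun l => a l + b l) = tupleSum m a + tupleSum m b :=
  Finset.sum_add_distrib

end TupleSums

section Bessel

variable {σ : Type*}

/-- Iterated partial derivative along a list of variables. -/
noncomputable def iterPderiv : List σ → MvPolynomial σ ℝ → MvPolynomial σ ℝ
  | [], F => F
  | j :: l, F => iterPderiv l (pderiv j F)

lemma pderiv_comm' (i j : σ) (F : MvPolynomial σ ℝ) :
    pderiv i (pderiv j F) = pderiv j (pderiv i F) := by
  classical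
  induction F using MvPolynomial.induction_on with
  | C a => simp
  | add p q hp hq => simp [hp, hq]
  | mul_X p n hp =>
    simp only [pderiv_mul, pderiv_X, map_add, hp, Pi.single_apply]
    split_ifs <;> (simp; try ring)

lemma iterPderiv_add (l : List σ) (F G : MvPolynomial σ ℝ) :
    iterPderiv l (F + G) = iterPderiv l F + iterPderiv l G := by
  induction l generalizing F G with
  | nil => rfl
  | cons j l ih => simp [iterPderiv, ih]

lemma iterPderiv_zero (l : List σ) : iterPderiv l (0 : MvPolynomial σ ℝ) = 0 := by
  induction l with
  | nil => rfl
  | cons j l ih => simp [iterPderiv, ih]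

variable [Fintype σ]

/-- The order `m` part of the Gaussian covariance of two polynomials. -/
noncomputable def levelForm (m : ℕ) (F G : MvPolynomial σ ℝ) : ℝ :=
  tupleSum m fun l => gaussE (iterPderiv l F) * gaussE (iterPderiv l G)

lemma levelForm_zero (F G : MvPolynomial σ ℝ) : levelForm 0 F G = gaussE F * gaussE G := by
  simp [levelForm, tupleSum_zero, iterPderiv]

lemma levelForm_succ (m : ℕ) (F G : MvPolynomial σ ℝ) :
    levelForm (m + 1) F G = ∑ j, levelForm m (pderiv j F) (pderiv j G) := by
  simp [levelForm, tupleSum_succ, iterPderiv]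

lemma levelForm_add_right (m : ℕ) (F G H : MvPolynomial σ ℝ) :
    levelForm m F (G + H) = levelForm m F G + levelForm m F H := by
  simp [levelForm, iterPderiv_add, mul_add, tupleSum_add]

lemma levelForm_zero_right (m : ℕ) (F : MvPolynomial σ ℝ) : levelForm m F 0 = 0 := by
  simp [levelForm, iterPderiv_zero, tupleSum]

/-- By the Leibniz rule, either no derivative hits `X i`, and Stein's identity applies, or one of
the `m` derivatives does, which leaves `pderiv i` on the side of `F`. -/
lemma levelForm_X_mul [DecidableEq σ] (m : ℕ) (i : σ) (F G : MvPolynomial σ ℝ) :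
    levelForm m F (X i * G) =
      levelForm m F (pderiv i G) + m * levelForm (m - 1) (pderiv i F) G := by
  induction m generalizing F G with
  | zero => simp [levelForm_zero, gaussE_X_mul]
  | succ m ih =>
    have h1 : ∀ j, levelForm m (pderiv j F) (pderiv j (X i * G)) =
        (levelForm m (pderiv j F) (pderiv j (pderiv i G))
          + m * levelForm (m - 1) (pderiv j (pderiv i F)) (pderiv j G))
        + if j = i then levelForm m (pderiv i F) G else 0 := by
      intro j
      have h2 : pderiv j (X i * G) = X i * pderiv j G + if j = i then G else 0 := by
        rw [pderiv_mul, pderiv_X, Pi.single_apply]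
        by_cases h : i = j
        · subst h; simp; ring
        · simp [h, Ne.symm h]
      rw [h2, levelForm_add_right, ih, pderiv_comm' i j, pderiv_comm' i j]
      by_cases h : j = i
      · simp [h]
      · simp [h, levelForm_zero_right]
    rw [levelForm_succ, Finset.sum_congr rfl fun j _ => h1 j, Finset.sum_add_distrib,
      Finset.sum_add_distrib, Finset.sum_ite_eq' Finset.univ i, levelForm_succ,
      ← Finset.mul_sum]
    simp only [Finset.mem_univ, if_true, Nat.add_sub_cancel]
    rcases m with _ | m
    · simp
    · rw [Nat.add_sub_cancel, ← levelForm_succ m, ← levelForm_succ (m + 1)]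
      push_cast
      ring

lemma levelForm_C (m : ℕ) (F : MvPolynomial σ ℝ) (c : ℝ) :
    levelForm (m + 1) F (C c) = 0 := by
  simp [levelForm_succ, levelForm_zero_right]

/-- The weight `1 / m!` absorbs the factor `m` and lowers the level by one, hence the shorter range
in the last sum. -/
lemma sum_levelForm_X_mul [DecidableEq σ] (N : ℕ) (i : σ) (F G : MvPolynomial σ ℝ) :
    ∑ m ∈ Finset.range (N + 1), ((m.factorial : ℝ))⁻¹ * levelForm m F (X i * G) =
      ∑ m ∈ Finset.range (N + 1), ((m.factorial : ℝ))⁻¹ * levelForm m F (pderiv i G) +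
        ∑ m ∈ Finset.range N, ((m.factorial : ℝ))⁻¹ * levelForm m (pderiv i F) G := by
  simp only [levelForm_X_mul, mul_add, Finset.sum_add_distrib]
  congr 1
  rw [Finset.sum_range_succ']
  simp only [Nat.cast_zero, zero_mul, mul_zero, add_zero, Nat.add_sub_cancel]
  refine Finset.sum_congr rfl fun m _ => ?_
  rw [Nat.factorial_succ]
  push_cast
  field_simp

/-- Both sides obey the same recursion when a variable is peeled off the monomial: `X i` is traded
for `pderiv i` on each of the two factors. Levels above the degree contribute nothing, so every
large enough `N` gives the same sum. -/
lemma gaussE_mul_monomial [DecidableEq σ] (d : ℕ) (s : σ →₀ ℕ) (hs : s.degree = d) (N : ℕ)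
    (hN : d + 1 ≤ N) (a : ℝ) (F : MvPolynomial σ ℝ) :
    gaussE (F * monomial s a) =
      ∑ m ∈ Finset.range N, ((m.factorial : ℝ))⁻¹ * levelForm m F (monomial s a) := by
  induction d using Nat.strong_induction_on generalizing s N a F with
  | _ d ih =>
    obtain ⟨N, rfl⟩ : ∃ N', N = N' + 1 := ⟨N - 1, by omega⟩
    by_cases h0 : s = 0
    · subst h0
      change gaussE (F * C a) = ∑ m ∈ Finset.range (N + 1), _ * levelForm m F (C a)
      rw [Finset.sum_range_succ']
      simp only [levelForm_C, mul_zero, Finset.sum_const_zero, levelForm_zero, gaussE_C]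
      rw [mul_comm F, C_mul', map_smul]
      simp [mul_comm]
    · obtain ⟨i, hi⟩ := Finsupp.ne_iff.1 h0
      have hi : s i ≠ 0 := hi
      set s' := s - Finsupp.single i 1 with hs'
      have hss : s = Finsupp.single i 1 + s' := by
        rw [hs', add_tsub_cancel_of_le]
        rw [Finsupp.single_le_iff]
        omega
      have hd : 1 + s'.degree = d := by
        rw [← hs, hss, map_add, Finsupp.degree_single]
      have hX : monomial s a = X i * monomial s' a := by
        rw [X, monomial_mul, one_mul, ← hss]
      have hd' : (s' - Finsupp.single i 1 : σ →₀ ℕ).degree ≤ s'.degree :=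
        Finsupp.degree_mono tsub_le_self
      rw [hX, sum_levelForm_X_mul, ← ih s'.degree (by omega) s' rfl N (by omega),
        pderiv_monomial, ← ih _ (by omega) _ rfl (N + 1) (by omega), ← pderiv_monomial,
        mul_left_comm, gaussE_X_mul, pderiv_mul, map_add, add_comm]

/-- Expansion of a Gaussian inner product of polynomials into expected derivatives. -/
lemma exists_forall_gaussE_mul_eq [DecidableEq σ] (G : MvPolynomial σ ℝ) :
    ∃ N₀ : ℕ, ∀ N, N₀ ≤ N → ∀ F : MvPolynomial σ ℝ,
      gaussE (F * G) = ∑ m ∈ Finset.range N, ((m.factorial : ℝ))⁻¹ * levelForm m F G := by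
  induction G using MvPolynomial.induction_on' with
  | monomial s a => exact ⟨_, fun N hN F => gaussE_mul_monomial _ s rfl N hN a F⟩
  | add p q hp hq =>
    obtain ⟨N₁, h₁⟩ := hp
    obtain ⟨N₂, h₂⟩ := hq
    refine ⟨max N₁ N₂, fun N hN F => ?_⟩
    rw [mul_add, map_add, h₁ N (le_trans (le_max_left _ _) hN),
      h₂ N (le_trans (le_max_right _ _) hN)]
    simp only [levelForm_add_right, mul_add, Finset.sum_add_distrib]

/-- Bessel's inequality for the expected derivatives of a polynomial. -/
lemma sum_levelForm_le [DecidableEq σ] (N : ℕ) (F : MvPolynomial σ ℝ) :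
    ∑ m ∈ Finset.range N, ((m.factorial : ℝ))⁻¹ * levelForm m F F ≤ gaussE (F * F) := by
  obtain ⟨N₀, h⟩ := exists_forall_gaussE_mul_eq F
  rw [h (max N N₀) (le_max_right _ _)]
  refine Finset.sum_le_sum_of_subset_of_nonneg
    (Finset.range_mono (le_max_left _ _)) fun m _ _ => ?_
  exact mul_nonneg (by positivity) (Finset.sum_nonneg fun t _ => mul_self_nonneg _)

/-- Cauchy-Schwarz against the expected derivatives of a polynomial. -/
lemma sq_sum_tupleSum_le [DecidableEq σ] (N : ℕ) (κ : List σ → ℝ) (F : MvPolynomial σ ℝ) :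
    (∑ m ∈ Finset.range N, ((m.factorial : ℝ))⁻¹ *
        tupleSum m fun l => κ l * gaussE (iterPderiv l F)) ^ 2 ≤
      (∑ m ∈ Finset.range N, ((m.factorial : ℝ))⁻¹ * tupleSum m fun l => κ l ^ 2) *
        gaussE (F * F) := by
  -- All levels are merged into one finite sum over pairs (length, tuple), where the weighted
  -- Cauchy-Schwarz inequality applies at once.
  have e : ∀ a : List σ → ℝ, ∑ m ∈ Finset.range N, ((m.factorial : ℝ))⁻¹ * tupleSum m a =
      ∑ x ∈ (Finset.range N).sigma fun m => (Finset.univ : Finset (Fin m → σ)),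
        ((x.1.factorial : ℝ))⁻¹ * a (List.ofFn x.2) := fun a => by
    simp only [tupleSum, Finset.mul_sum, Finset.sum_sigma']
  refine le_trans ?_ (mul_le_mul_of_nonneg_left (sum_levelForm_le N F) ?_)
  · simp only [levelForm]
    rw [e, e, e]
    refine Finset.sum_sq_le_sum_mul_sum_of_sq_le_mul _ (fun x _ => ?_) (fun x _ => ?_)
      (fun x _ => ?_)
    · positivity
    · exact mul_nonneg (by positivity) (mul_self_nonneg _)
    · exact le_of_eq (by ring)
  · exact Finset.sum_nonneg fun m _ => mul_nonneg (by positivity)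
      (Finset.sum_nonneg fun t _ => sq_nonneg _)

end Bessel

end Biclustering

namespace Biclustering

open MvPolynomial

/-! ### Cumulants as deconvolution on multisets -/

section Cumulants

variable {σ : Type*}

/-- Convolution of functions of multisets, a sub-multiset being counted with its multiplicity. -/
def msConv (f g : Multiset σ → ℝ) (s : Multiset σ) : ℝ :=
  (s.antidiagonal.map fun p => f p.1 * g p.2).sum

/-- The function `κ` of multisets with `ν = κ * μ` (for `μ 0 = 1`): when `ν` and `μ` are the
mixed moments with and without a factor `x`, these are the joint cumulants with `x`. -/
noncomputable def cumulant (ν μ : Multiset σ → ℝ) (s : Multiset σ) : ℝ :=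
  ν s - (((s.antidiagonal.filter fun p => p.1.card < s.card).attach.map
    fun p => cumulant ν μ p.1.1 * μ p.1.2)).sum
termination_by s.card
decreasing_by exact (Multiset.mem_filter.1 p.2).2

lemma cumulant_eq (ν μ : Multiset σ → ℝ) (s : Multiset σ) :
    cumulant ν μ s = ν s - ((s.antidiagonal.filter fun p => p.1.card < s.card).map
      fun p => cumulant ν μ p.1 * μ p.2).sum := by
  rw [cumulant]
  congr 2
  exact Multiset.attach_map_val' _ (fun p : Multiset σ × Multiset σ => cumulant ν μ p.1 * μ p.2)

lemma filter_snd_eq_zero_antidiagonal (s : Multiset σ) :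
    (s.antidiagonal.filter fun p => p.2.card = 0) = {(s, 0)} := by
  induction s using Multiset.induction_on with
  | empty => rfl
  | cons a s ih =>
    rw [Multiset.antidiagonal_cons, Multiset.filter_add, Multiset.filter_map, Multiset.filter_map]
    have h1 : (s.antidiagonal.filter
        ((fun p : Multiset σ × Multiset σ => p.2.card = 0) ∘ Prod.map id (Multiset.cons a))) = 0 := by
      rw [Multiset.filter_eq_nil]
      intro p _
      simp
    have h2 : (s.antidiagonal.filter
        ((fun p : Multiset σ × Multiset σ => p.2.card = 0) ∘ Prod.map (Multiset.cons a) id)) =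
        {(s, 0)} := by
      rw [← ih]
      rfl
    rw [h1, h2]
    simp

lemma msConv_eq (f g : Multiset σ → ℝ) (s : Multiset σ) :
    msConv f g s = f s * g 0 + ((s.antidiagonal.filter fun p => p.1.card < s.card).map
      fun p => f p.1 * g p.2).sum := by
  have h := Multiset.filter_add_not (fun p : Multiset σ × Multiset σ => p.2.card = 0)
    s.antidiagonal
  have h2 : (s.antidiagonal.filter fun p => ¬ p.2.card = 0) =
      s.antidiagonal.filter fun p => p.1.card < s.card := by
    refine Multiset.filter_congr fun p hp => ?_
    rw [← Multiset.mem_antidiagonal.1 hp, Multiset.card_add]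
    omega
  rw [filter_snd_eq_zero_antidiagonal, h2] at h
  rw [msConv, ← h, Multiset.map_add, Multiset.sum_add]
  simp

lemma msConv_cumulant (ν μ : Multiset σ → ℝ) (hμ : μ 0 = 1) (s : Multiset σ) :
    msConv (cumulant ν μ) μ s = ν s := by
  rw [msConv_eq, hμ, cumulant_eq]
  ring

lemma sum_antidiagonal_pow_card (c : ℝ) (s : Multiset σ) :
    (s.antidiagonal.map fun p => c ^ p.1.card).sum = (c + 1) ^ s.card := by
  have h := Multiset.prod_map_add (s := s) (f := fun _ => c) (g := fun _ => (1 : ℝ))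
  simpa using h.symm

/-- In the recursion with `m = s.card`, every proper sub-multiset `t` contributes at most `m ^
t.card * ν s`. The binomial formula sums these to `((m + 1) ^ m - m ^ m) * ν s`, and `m ^ m ≥ 1`
leaves room for the leading term `ν s`. -/
lemma abs_cumulant_le {ν μ : Multiset σ → ℝ} (hν : ∀ s, 0 ≤ ν s) (hμ : ∀ s, 0 ≤ μ s)
    (h : ∀ t u, ν t * μ u ≤ ν (t + u)) (s : Multiset σ) :
    |cumulant ν μ s| ≤ ((s.card : ℝ) + 1) ^ s.card * ν s := by
  induction s using Multiset.strongInductionOn with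
  | _ s ih =>
  rcases s.card.eq_zero_or_pos with h0 | hpos
  · rw [Multiset.card_eq_zero] at h0
    subst h0
    rw [cumulant_eq]
    simp [abs_of_nonneg (hν 0)]
  · set m : ℝ := (s.card : ℝ) with hm
    have hm1 : 1 ≤ m := by rw [hm]; exact_mod_cast hpos
    have hbound : |((s.antidiagonal.filter fun p => p.1.card < s.card).map
        fun p => cumulant ν μ p.1 * μ p.2).sum| ≤
        ((s.antidiagonal.filter fun p => p.1.card < s.card).map
          fun p => m ^ p.1.card * ν s).sum := by
      refine (Multiset.abs_sum_le_sum_abs).trans ?_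
      rw [Multiset.map_map]
      refine Multiset.sum_map_le_sum_map _ _ fun p hp => ?_
      obtain ⟨hp1, hp2⟩ := Multiset.mem_filter.1 hp
      have hps := Multiset.mem_antidiagonal.1 hp1
      have hlt : p.1 < s := lt_of_le_of_ne (hps ▸ Multiset.le_add_right _ _)
        (fun h => by rw [h] at hp2; exact lt_irrefl _ hp2)
      simp only [Function.comp_apply, abs_mul, abs_of_nonneg (hμ p.2)]
      calc |cumulant ν μ p.1| * μ p.2 ≤ ((p.1.card : ℝ) + 1) ^ p.1.card * ν p.1 * μ p.2 :=
            mul_le_mul_of_nonneg_right (ih _ hlt) (hμ _)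
        _ = ((p.1.card : ℝ) + 1) ^ p.1.card * (ν p.1 * μ p.2) := by ring
        _ ≤ m ^ p.1.card * ν s := by
            refine mul_le_mul (pow_le_pow_left₀ (by positivity) ?_ _) (hps ▸ h _ _)
              (mul_nonneg (hν _) (hμ _)) (by positivity)
            rw [hm]
            exact_mod_cast hp2
    have htot := msConv_eq (fun t => m ^ t.card * ν s) (fun _ => 1) s
    simp only [msConv, mul_one] at htot
    rw [Multiset.sum_map_mul_right, sum_antidiagonal_pow_card] at htot
    have hpow : 1 ≤ m ^ s.card := one_le_pow₀ hm1
    rw [cumulant_eq]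
    have := abs_sub (ν s) ((s.antidiagonal.filter fun p => p.1.card < s.card).map
        fun p => cumulant ν μ p.1 * μ p.2).sum
    rw [abs_of_nonneg (hν s)] at this
    nlinarith [hν s, mul_le_mul_of_nonneg_right hpow (hν s)]

lemma msConv_cons (f g : Multiset σ → ℝ) (a : σ) (s : Multiset σ) :
    msConv f g (a ::ₘ s) = msConv f (fun u => g (a ::ₘ u)) s +
      msConv (fun t => f (a ::ₘ t)) g s := by
  simp [msConv, Multiset.antidiagonal_cons, Multiset.map_map]

/-- Cumulants vanish when the variables split into two independent blocks. -/
lemma cumulant_eq_zero {ν μ : Multiset σ → ℝ} (hμ : μ 0 = 1) (A B : Set σ) (hAB : Disjoint A B)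
    (hν' : ∀ t u : Multiset σ, (∀ e ∈ t, e ∈ A) → (∀ e ∈ u, e ∈ B) → ν (t + u) = ν t * μ u)
    (hμ' : ∀ t u : Multiset σ, (∀ e ∈ t, e ∈ A) → (∀ e ∈ u, e ∈ B) → μ (t + u) = μ t * μ u)
    (t u : Multiset σ) (ht : ∀ e ∈ t, e ∈ A) (hu : ∀ e ∈ u, e ∈ B) (hu0 : u ≠ 0) :
    cumulant ν μ (t + u) = 0 := by
  classical
  -- The cumulant cut off outside `A` still solves `ν = κ' * μ` on multisets in `A ∪ B`. The
  -- triangular recursion has a unique solution there, so it agrees with the cumulant.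
  set κ' : Multiset σ → ℝ := fun s => if ∀ e ∈ s, e ∈ A then cumulant ν μ s else 0 with hκ'
  have key : ∀ (u : Multiset σ), (∀ e ∈ u, e ∈ B) → ∀ (g : Multiset σ → ℝ) (t : Multiset σ),
      msConv κ' g (t + u) = msConv κ' (fun v => g (v + u)) t := by
    intro u
    induction u using Multiset.induction_on with
    | empty => intro _ g t; simp
    | cons b u ih =>
      intro hb g t
      have hbA : b ∉ A := fun h => hAB.le_bot ⟨h, hb b (Multiset.mem_cons_self _ _)⟩
      have h0 : (fun t => κ' (b ::ₘ t)) = fun _ => 0 := by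
        funext t
        simp [hκ', hbA]
      rw [Multiset.add_cons, msConv_cons, h0,
        ih (fun e he => hb e (Multiset.mem_cons_of_mem he))]
      simp [msConv]
  have hκA : ∀ t : Multiset σ, (∀ e ∈ t, e ∈ A) → ∀ g, msConv κ' g t = msConv (cumulant ν μ) g t := by
    intro t ht g
    unfold msConv
    congr 1
    refine Multiset.map_congr rfl fun p hp => ?_
    have hps := Multiset.mem_antidiagonal.1 hp
    have : ∀ e ∈ p.1, e ∈ A := fun e he => ht e (hps ▸ Multiset.mem_add.2 (Or.inl he))
    simp only [hκ', if_pos this]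
  have hconv : ∀ t u : Multiset σ, (∀ e ∈ t, e ∈ A) → (∀ e ∈ u, e ∈ B) →
      msConv κ' μ (t + u) = ν (t + u) := by
    intro t u ht hu
    rw [key u hu, hν' t u ht hu, ← msConv_cumulant ν μ hμ t, hκA t ht]
    unfold msConv
    rw [← Multiset.sum_map_mul_right]
    congr 1
    refine Multiset.map_congr rfl fun p hp => ?_
    have hps := Multiset.mem_antidiagonal.1 hp
    dsimp only
    rw [hμ' p.2 u (fun e he => ht e (hps ▸ Multiset.mem_add.2 (Or.inr he))) hu]
    ring
  have main : ∀ s : Multiset σ, (∀ e ∈ s, e ∈ A ∪ B) → cumulant ν μ s = κ' s := by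
    intro s
    induction s using Multiset.strongInductionOn with
    | _ s ih =>
    intro hs
    have h1 : s = s.filter (· ∈ A) + s.filter (· ∉ A) := (Multiset.filter_add_not _ _).symm
    have h2 : msConv κ' μ s = ν s := by
      rw [h1]
      refine hconv _ _ (fun e he => (Multiset.mem_filter.1 he).2) fun e he => ?_
      obtain ⟨he1, he2⟩ := Multiset.mem_filter.1 he
      exact (hs e he1).resolve_left he2
    rw [msConv_eq, hμ, mul_one] at h2
    rw [cumulant_eq, ← h2]
    have h3 : ((s.antidiagonal.filter fun p => p.1.card < s.card).map
        fun p => cumulant ν μ p.1 * μ p.2) =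
        ((s.antidiagonal.filter fun p => p.1.card < s.card).map fun p => κ' p.1 * μ p.2) := by
      refine Multiset.map_congr rfl fun p hp => ?_
      obtain ⟨hp1, hp2⟩ := Multiset.mem_filter.1 hp
      have hps := Multiset.mem_antidiagonal.1 hp1
      have hle : p.1 ≤ s := hps ▸ Multiset.le_add_right _ _
      have hlt : p.1 < s := lt_of_le_of_ne hle
        (fun h => by rw [h] at hp2; exact lt_irrefl _ hp2)
      rw [ih _ hlt fun e he => hs e (Multiset.mem_of_le hle he)]
    rw [h3]
    ring
  rw [main (t + u) fun e he => (Multiset.mem_add.1 he).elim (fun h => Or.inl (ht e h))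
    fun h => Or.inr (hu e h)]
  obtain ⟨b, hb⟩ := Multiset.exists_mem_of_ne_zero hu0
  refine if_neg fun h => ?_
  exact hAB.le_bot ⟨h b (Multiset.mem_add.2 (Or.inr hb)), hu b hb⟩

end Cumulants

/-! ### The differential operator whose symbol is the cumulant -/

section CumulantOperator

variable {σ : Type*} [Fintype σ]

omit [Fintype σ] in
lemma iterPderiv_smul (l : List σ) (c : ℝ) (F : MvPolynomial σ ℝ) :
    iterPderiv l (c • F) = c • iterPderiv l F := by
  induction l generalizing F with
  | nil => rfl
  | cons j l ih => simp [iterPderiv, ih]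

/-- The order `m` part of the differential operator with symbol `κ`. -/
noncomputable def levelOp (m : ℕ) (κ : Multiset σ → ℝ) (P : MvPolynomial σ ℝ) :
    MvPolynomial σ ℝ :=
  tupleSum m fun l => κ l • iterPderiv l P

/-- The differential operator with symbol `κ`, truncated at order `< N`. -/
noncomputable def symbolOp (N : ℕ) (κ : Multiset σ → ℝ) (P : MvPolynomial σ ℝ) :
    MvPolynomial σ ℝ :=
  ∑ m ∈ Finset.range N, ((m.factorial : ℝ))⁻¹ • levelOp m κ P

lemma levelOp_zero (κ : Multiset σ → ℝ) (P : MvPolynomial σ ℝ) :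
    levelOp 0 κ P = κ 0 • P := by
  simp [levelOp, tupleSum_zero, iterPderiv]

lemma levelOp_succ (m : ℕ) (κ : Multiset σ → ℝ) (P : MvPolynomial σ ℝ) :
    levelOp (m + 1) κ P = ∑ j, levelOp m (fun s => κ (j ::ₘ s)) (pderiv j P) := by
  simp [levelOp, tupleSum_succ, iterPderiv]

lemma levelOp_add (m : ℕ) (κ : Multiset σ → ℝ) (P Q : MvPolynomial σ ℝ) :
    levelOp m κ (P + Q) = levelOp m κ P + levelOp m κ Q := by
  simp [levelOp, iterPderiv_add, smul_add, tupleSum_add]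

lemma levelOp_zero_right (m : ℕ) (κ : Multiset σ → ℝ) :
    levelOp m κ (0 : MvPolynomial σ ℝ) = 0 := by
  simp [levelOp, iterPderiv_zero, tupleSum]

lemma levelOp_smul (m : ℕ) (κ : Multiset σ → ℝ) (c : ℝ) (P : MvPolynomial σ ℝ) :
    levelOp m κ (c • P) = c • levelOp m κ P := by
  simp [levelOp, iterPderiv_smul, tupleSum, Finset.smul_sum, smul_comm c]

lemma levelOp_X_mul [DecidableEq σ] (m : ℕ) (κ : Multiset σ → ℝ) (i : σ) (P : MvPolynomial σ ℝ) :
    levelOp m κ (X i * P) =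
      X i * levelOp m κ P + (m : ℝ) • levelOp (m - 1) (fun s => κ (i ::ₘ s)) P := by
  induction m generalizing κ P with
  | zero => simp [levelOp_zero]
  | succ m ih =>
    have h1 : ∀ j, levelOp m (fun s => κ (j ::ₘ s)) (pderiv j (X i * P)) =
        (X i * levelOp m (fun s => κ (j ::ₘ s)) (pderiv j P)
          + (m : ℝ) • levelOp (m - 1) (fun s => κ (i ::ₘ j ::ₘ s)) (pderiv j P))
        + if j = i then levelOp m (fun s => κ (i ::ₘ s)) P else 0 := by
      intro j
      have h2 : pderiv j (X i * P) = X i * pderiv j P + if j = i then P else 0 := by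
        rw [pderiv_mul, pderiv_X, Pi.single_apply]
        by_cases h : i = j
        · subst h; simp; ring
        · simp [h, Ne.symm h]
      rw [h2, levelOp_add, ih]
      simp only [Multiset.cons_swap j i]
      by_cases h : j = i
      · simp [h]
      · simp [h, levelOp_zero_right]
    rw [levelOp_succ, Finset.sum_congr rfl fun j _ => h1 j, Finset.sum_add_distrib,
      Finset.sum_add_distrib, Finset.sum_ite_eq' Finset.univ i, levelOp_succ,
      ← Finset.mul_sum, ← Finset.smul_sum]
    simp only [Finset.mem_univ, if_true, Nat.add_sub_cancel]
    rcases m with _ | m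
    · simp
    · rw [Nat.add_sub_cancel, ← levelOp_succ m (fun s => κ (i ::ₘ s))]
      push_cast
      module

/-- Commuting the operator past `X i` differentiates its symbol, that is, prepends `i` to the
argument of `κ`. This mirrors the recursion `msConv_cons`, so on monomials the operator acts as a
convolution. -/
lemma symbolOp_X_mul [DecidableEq σ] (N : ℕ) (κ : Multiset σ → ℝ) (i : σ)
    (P : MvPolynomial σ ℝ) :
    symbolOp (N + 1) κ (X i * P) =
      X i * symbolOp (N + 1) κ P + symbolOp N (fun s => κ (i ::ₘ s)) P := by
  simp only [symbolOp, levelOp_X_mul, smul_add, Finset.sum_add_distrib, Finset.mul_sum]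
  congr 1
  · simp
  · rw [Finset.sum_range_succ']
    simp only [Nat.cast_zero, zero_smul, smul_zero, add_zero, Nat.add_sub_cancel, smul_smul]
    refine Finset.sum_congr rfl fun m _ => ?_
    rw [Nat.factorial_succ]
    congr 1
    push_cast
    field_simp

lemma symbolOp_add (N : ℕ) (κ : Multiset σ → ℝ) (P Q : MvPolynomial σ ℝ) :
    symbolOp N κ (P + Q) = symbolOp N κ P + symbolOp N κ Q := by
  simp [symbolOp, levelOp_add, Finset.sum_add_distrib]

lemma symbolOp_smul (N : ℕ) (κ : Multiset σ → ℝ) (c : ℝ) (P : MvPolynomial σ ℝ) :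
    symbolOp N κ (c • P) = c • symbolOp N κ P := by
  simp [symbolOp, levelOp_smul, Finset.smul_sum, smul_comm c]

lemma symbolOp_one (N : ℕ) (κ : Multiset σ → ℝ) :
    symbolOp (N + 1) κ (1 : MvPolynomial σ ℝ) = κ 0 • 1 := by
  rw [symbolOp, Finset.sum_range_succ', Finset.sum_eq_zero]
  · simp [levelOp_zero]
  · intro m _
    simp [levelOp_succ, levelOp_zero_right]

/-- The value of `symbolOp` on monomials. -/
lemma eval_symbolOp_prod [DecidableEq σ] (s : Multiset σ) (N : ℕ) (hN : s.card < N)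
    (κ : Multiset σ → ℝ) (x : σ → ℝ) :
    eval x (symbolOp N κ (s.map X).prod) = msConv κ (fun u => (u.map x).prod) s := by
  induction s using Multiset.induction_on generalizing N κ with
  | empty =>
    obtain ⟨N, rfl⟩ : ∃ N', N = N' + 1 := ⟨N - 1, by simp at hN; omega⟩
    simp [symbolOp_one, msConv]
  | cons a s ih =>
    rw [Multiset.card_cons] at hN
    obtain ⟨N, rfl⟩ : ∃ N', N = N' + 1 := ⟨N - 1, by omega⟩
    rw [Multiset.map_cons, Multiset.prod_cons, symbolOp_X_mul, map_add, map_mul, eval_X,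
      ih _ (by omega), ih _ (by omega), msConv_cons]
    congr 1
    simp only [Multiset.map_cons, Multiset.prod_cons, msConv, ← Multiset.sum_map_mul_left]
    congr 1
    refine Multiset.map_congr rfl fun p _ => ?_
    ring

variable {Ω : Type*} [Fintype Ω]

/-- Mixed moments of a random vector `X`, weighted by `x`, under weights `w`. -/
def mixedMoment (w : Ω → ℝ) (X : Ω → σ → ℝ) (s : Multiset σ) : ℝ :=
  ∑ z, w z * (s.map (X z)).prod

omit [Fintype σ] in
lemma monomial_eq_smul_prod (s : σ →₀ ℕ) (a : ℝ) :
    (monomial s a : MvPolynomial σ ℝ) = a • ((Finsupp.toMultiset s).map X).prod := by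
  rw [← C_mul', monomial_eq, Finsupp.toMultiset_map, Finsupp.prod_toMultiset,
    Finsupp.prod_mapDomain_index (fun _ => pow_zero _) (fun _ _ _ => pow_add _ _ _)]

/-- On monomials this is `ν = κ * μ`, with `μ` read as moments under `v`; linearity extends it. It
trades a change of weights for a differential operator on the test polynomial. -/
lemma sum_eval_eq_sum_eval_symbolOp [DecidableEq σ] {ν μ : Multiset σ → ℝ} (w v : Ω → ℝ)
    (Y : Ω → σ → ℝ) (hν : ∀ s, ν s = mixedMoment w Y s) (hμ : ∀ s, μ s = mixedMoment v Y s)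
    (hμ0 : μ 0 = 1) (N : ℕ) (P : MvPolynomial σ ℝ) (hP : P.totalDegree < N) :
    ∑ z, w z * eval (Y z) P = ∑ z, v z * eval (Y z) (symbolOp N (cumulant ν μ) P) := by
  have hmon : ∀ s : Multiset σ, s.card < N →
      ∑ z, w z * eval (Y z) (s.map X).prod =
        ∑ z, v z * eval (Y z) (symbolOp N (cumulant ν μ) (s.map X).prod) := by
    intro s hs
    have h1 : ∀ z, eval (Y z) (s.map X).prod = (s.map (Y z)).prod := fun z => by
      rw [map_multiset_prod, Multiset.map_map]
      congr 1
      exact Multiset.map_congr rfl fun i _ => eval_X i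
    simp only [h1, eval_symbolOp_prod s N hs]
    rw [← mixedMoment, ← hν, ← msConv_cumulant ν μ hμ0 s]
    simp only [msConv, hμ, mixedMoment]
    induction s.antidiagonal using Multiset.induction_on with
    | empty => simp
    | cons p T ih =>
      simp only [Multiset.map_cons, Multiset.sum_cons, mul_add, Finset.sum_add_distrib, ih]
      rw [Finset.mul_sum]
      congr 1
      exact Finset.sum_congr rfl fun z _ => by ring
  have hfin : ∀ T : Finset (σ →₀ ℕ), (∀ s ∈ T, (Finsupp.toMultiset s).card < N) →
      ∀ c : (σ →₀ ℕ) → ℝ,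
      ∑ z, w z * eval (Y z) (∑ s ∈ T, monomial s (c s)) =
        ∑ z, v z * eval (Y z) (symbolOp N (cumulant ν μ) (∑ s ∈ T, monomial s (c s))) := by
    classical
    intro T
    induction T using Finset.induction_on with
    | empty =>
      intro _ c
      have := symbolOp_smul N (cumulant ν μ) 0 0
      rw [zero_smul, zero_smul] at this
      simp [this]
    | insert a T ha ih =>
      intro hT c
      rw [Finset.sum_insert ha, symbolOp_add, monomial_eq_smul_prod, symbolOp_smul]
      simp only [map_add, smul_eval, mul_add, Finset.sum_add_distrib, mul_left_comm _ (c a),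
        ← Finset.mul_sum]
      rw [ih (fun s hs => hT s (Finset.mem_insert_of_mem hs)),
        hmon _ (hT a (Finset.mem_insert_self _ _))]
  rw [← support_sum_monomial_coeff P]
  refine hfin _ (fun s hs => ?_) _
  rw [Finsupp.card_toMultiset]
  exact (le_totalDegree hs).trans_lt hP

end CumulantOperator

end Biclustering

namespace Biclustering

/-! ### Probabilities of monochromatic edges as subgroup indices -/

section Labelings

variable {R C : Type*} {k : ℕ}

/-- The labelings of rows and columns for which all edges `(i, j)` in `s` are monochromatic. -/
def mono (k : ℕ) (s : Multiset (R × C)) : AddSubgroup (R ⊕ C → ZMod k) where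
  carrier := {z | ∀ e ∈ s, z (Sum.inl e.1) = z (Sum.inr e.2)}
  zero_mem' := fun _ _ => rfl
  add_mem' := fun ha hb e he => by simp [ha e he, hb e he]
  neg_mem' := fun ha e he => by simp [ha e he]

lemma mem_mono {s : Multiset (R × C)} {z : R ⊕ C → ZMod k} :
    z ∈ mono k s ↔ ∀ e ∈ s, z (Sum.inl e.1) = z (Sum.inr e.2) := Iff.rfl

lemma mono_add (s t : Multiset (R × C)) : mono k (s + t) = mono k s ⊓ mono k t := by
  ext z
  simp only [AddSubgroup.mem_inf, mem_mono, Multiset.mem_add, or_imp, forall_and]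

/-- The probability that all edges in `s` are monochromatic for a uniform random labeling. -/
noncomputable def monoProb (k : ℕ) (s : Multiset (R × C)) : ℝ := ((mono k s).index : ℝ)⁻¹

lemma monoProb_nonneg (s : Multiset (R × C)) : 0 ≤ monoProb k s := by
  unfold monoProb
  positivity

lemma monoProb_zero : monoProb k (0 : Multiset (R × C)) = 1 := by
  have : mono k (0 : Multiset (R × C)) = ⊤ := by
    ext z
    simp [mem_mono]
  simp [monoProb, this]

/-- Two subgroups that together generate the whole group are independent events: the index of the
intersection is the product of the indices. -/
lemma monoProb_add_of_sup_eq_top {s t : Multiset (R × C)} (h : mono k s ⊔ mono k t = ⊤) :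
    monoProb k (s + t) = monoProb k s * monoProb k t := by
  have h1 : (mono k (s + t)).index = (mono k s).index * (mono k t).index := by
    rw [mono_add, ← AddSubgroup.relIndex_mul_index (inf_le_right : mono k s ⊓ mono k t ≤ _),
      AddSubgroup.inf_relIndex_right, ← AddSubgroup.relIndex_sup_left, h,
      AddSubgroup.relIndex_top_right]
  rw [monoProb, h1, Nat.cast_mul, mul_inv]
  rfl

/-- Independence of the monochromaticity of edges with disjoint sets of end points. -/
lemma monoProb_add_of_separated {s t : Multiset (R × C)} (U : Set (R ⊕ C))
    (hs : ∀ e ∈ s, Sum.inl e.1 ∈ U ∧ Sum.inr e.2 ∈ U)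
    (ht : ∀ e ∈ t, Sum.inl e.1 ∉ U ∧ Sum.inr e.2 ∉ U) :
    monoProb k (s + t) = monoProb k s * monoProb k t := by
  classical
  refine monoProb_add_of_sup_eq_top (eq_top_iff.2 fun z _ => ?_)
  have hz : z = (fun v => if v ∈ U then 0 else z v) + fun v => if v ∈ U then z v else 0 := by
    funext v
    by_cases hv : v ∈ U <;> simp [hv]
  rw [hz]
  refine AddSubgroup.add_mem_sup (fun e he => ?_) fun e he => ?_
  · simp [hs e he]
  · simp [ht e he]

variable [Finite R] [Finite C] [NeZero k]

lemma index_mono_pos (s : Multiset (R × C)) : 0 < ((mono k s).index : ℝ) :=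
  Nat.cast_pos.2 (Nat.pos_of_ne_zero AddSubgroup.index_ne_zero_of_finite)

lemma monoProb_mul_le (s t : Multiset (R × C)) :
    monoProb k s * monoProb k t ≤ monoProb k (s + t) := by
  unfold monoProb
  rw [← mul_inv, mono_add]
  refine inv_anti₀ ?_ ?_
  · rw [← mono_add]
    exact index_mono_pos _
  · exact_mod_cast AddSubgroup.index_inf_le

omit [NeZero k] [Finite R] [Finite C] in
lemma mono_anti {s t : Multiset (R × C)} (h : s ≤ t) : mono k t ≤ mono k s :=
  fun _ hz e he => hz e (Multiset.mem_of_le h he)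

lemma monoProb_anti {s t : Multiset (R × C)} (h : s ≤ t) : monoProb k t ≤ monoProb k s := by
  refine inv_anti₀ (index_mono_pos _) ?_
  exact_mod_cast Nat.le_of_dvd (Nat.pos_of_ne_zero AddSubgroup.index_ne_zero_of_finite)
    (AddSubgroup.index_dvd_of_le (mono_anti h))

omit [Finite R] [Finite C] in
lemma monoProb_singleton (e : R × C) : monoProb k {e} = (k : ℝ)⁻¹ := by
  classical
  let φ : (R ⊕ C → ZMod k) →+ ZMod k :=
    Pi.evalAddMonoidHom (fun _ : R ⊕ C => ZMod k) (Sum.inl e.1) -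
      Pi.evalAddMonoidHom (fun _ : R ⊕ C => ZMod k) (Sum.inr e.2)
  have hφ : φ.ker = mono k {e} := by
    ext z
    simp [φ, AddMonoidHom.mem_ker, mem_mono, sub_eq_zero]
  have hs : Function.Surjective φ := fun c =>
    ⟨Pi.single (Sum.inl e.1) c, by simp [φ]⟩
  rw [monoProb, ← hφ, AddSubgroup.index_ker, AddMonoidHom.range_eq_top.2 hs]
  simp

omit [Finite R] [Finite C] in
-- An end point of `e` unused by `s` can be relabeled freely: the correction `w` is supported there,
-- so it lies in `mono k s`, and it makes `e` monochromatic.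
lemma monoProb_cons_of_new {s : Multiset (R × C)} {e : R × C}
    (h : (∀ f ∈ s, e.1 ≠ f.1) ∨ ∀ f ∈ s, e.2 ≠ f.2) :
    monoProb k (e ::ₘ s) = (k : ℝ)⁻¹ * monoProb k s := by
  classical
  rw [← Multiset.singleton_add, ← monoProb_singleton e]
  refine monoProb_add_of_sup_eq_top (eq_top_iff.2 fun z _ => ?_)
  rcases h with h | h
  · set w : R ⊕ C → ZMod k := Pi.single (Sum.inl e.1) (z (Sum.inl e.1) - z (Sum.inr e.2))
    have hz : z = (z - w) + w := by abel
    rw [hz]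
    refine AddSubgroup.add_mem_sup (fun f hf => ?_) fun f hf => ?_
    · rw [Multiset.mem_singleton.1 hf]
      simp [w]
    · simp [w, (h f hf).symm]
  · set w : R ⊕ C → ZMod k := Pi.single (Sum.inr e.2) (z (Sum.inr e.2) - z (Sum.inl e.1))
    have hz : z = (z - w) + w := by abel
    rw [hz]
    refine AddSubgroup.add_mem_sup (fun f hf => ?_) fun f hf => ?_
    · rw [Multiset.mem_singleton.1 hf]
      simp [w]
    · simp [w, (h f hf).symm]

end Labelings

/-! ### Connected edge multisets and vanishing of cumulants -/

section Connected

variable {R C : Type*} {k : ℕ}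

/-- The edge `e` shares an end point with an edge in `s`. -/
def Touches (e : R × C) (s : Multiset (R × C)) : Prop := ∃ f ∈ s, e.1 = f.1 ∨ e.2 = f.2

/-- Multisets of edges which, together with `e₀`, form a connected graph. -/
inductive ConnectedTo (e₀ : R × C) : Multiset (R × C) → Prop
  | zero : ConnectedTo e₀ 0
  | cons {e : R × C} {s : Multiset (R × C)} (he : Touches e (e₀ ::ₘ s))
      (hs : ConnectedTo e₀ s) : ConnectedTo e₀ (e ::ₘ s)

/-- Touching edges are moved greedily from `u` to `A`; when none is left, `A'` is the part connected
to `e₀` and `u'` is vertex-disjoint from it. -/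
lemma exists_connectedTo_add (e₀ : R × C) (n : ℕ) (A u : Multiset (R × C)) (hn : u.card = n)
    (hA : ConnectedTo e₀ A) : ∃ A' u', A' + u' = A + u ∧ ConnectedTo e₀ A' ∧
      ∀ e ∈ u', ¬ Touches e (e₀ ::ₘ A') := by
  induction n generalizing A u with
  | zero =>
    rw [Multiset.card_eq_zero] at hn
    subst hn
    exact ⟨A, 0, rfl, hA, by simp⟩
  | succ n ih =>
    by_cases h : ∃ e ∈ u, Touches e (e₀ ::ₘ A)
    · obtain ⟨e, he, het⟩ := h
      obtain ⟨v, rfl⟩ := Multiset.exists_cons_of_mem he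
      obtain ⟨A', u', h1, h2⟩ := ih (e ::ₘ A) v (by simpa using hn) (.cons het hA)
      exact ⟨A', u', by simpa using h1, h2⟩
    · push Not at h
      exact ⟨A, u, rfl, hA, h⟩

/-- The moments of the planted entries `lam * 1{z i = z j}`. -/
noncomputable def plantedMoment (k : ℕ) (lam : ℝ) (s : Multiset (R × C)) : ℝ :=
  lam ^ s.card * monoProb k s

/-- The joint cumulants of `1{z i₀ = z j₀}`, for `e₀ = (i₀, j₀)`, with the planted entries. -/
noncomputable def plantedCumulant (k : ℕ) (lam : ℝ) (e₀ : R × C) : Multiset (R × C) → ℝ :=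
  cumulant (fun s => lam ^ s.card * monoProb k (e₀ ::ₘ s)) (plantedMoment k lam)

/-- Edges away from the component of `e₀` have end points outside its vertex set `U`, so they are
independent of `e₀` and the component. -/
lemma plantedCumulant_eq_zero (lam : ℝ) (e₀ : R × C) (s : Multiset (R × C))
    (hs : ¬ ConnectedTo e₀ s) : plantedCumulant k lam e₀ s = 0 := by
  obtain ⟨A, u, hAu, hA, hu⟩ := exists_connectedTo_add e₀ _ 0 s rfl .zero
  rw [zero_add] at hAu
  have hu0 : u ≠ 0 := by
    rintro rfl
    rw [add_zero] at hAu
    exact hs (hAu ▸ hA)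
  set U : Set (R ⊕ C) := {v | ∃ f ∈ e₀ ::ₘ A, v = Sum.inl f.1 ∨ v = Sum.inr f.2} with hU
  have hUmem : ∀ f ∈ e₀ ::ₘ A, Sum.inl f.1 ∈ U ∧ Sum.inr f.2 ∈ U := fun f hf =>
    ⟨⟨f, hf, Or.inl rfl⟩, ⟨f, hf, Or.inr rfl⟩⟩
  rw [← hAu]
  refine cumulant_eq_zero (by simp [plantedMoment, monoProb_zero])
    {e : R × C | Sum.inl e.1 ∈ U ∧ Sum.inr e.2 ∈ U}
    {e : R × C | Sum.inl e.1 ∉ U ∧ Sum.inr e.2 ∉ U}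
    (Set.disjoint_left.2 fun e h h' => h'.1 h.1) ?_ ?_ A u
    (fun e he => hUmem e (Multiset.mem_cons_of_mem he)) ?_ hu0
  · intro t v ht hv
    have : monoProb k ((e₀ ::ₘ t) + v) = monoProb k (e₀ ::ₘ t) * monoProb k v := by
      refine monoProb_add_of_separated U (fun e he => ?_) hv
      rcases Multiset.mem_cons.1 he with rfl | he
      · exact hUmem _ (Multiset.mem_cons_self _ _)
      · exact ht e he
    rw [← Multiset.cons_add, this, plantedMoment, Multiset.card_add, pow_add]
    ring
  · intro t v ht hv
    rw [plantedMoment, monoProb_add_of_separated U ht hv, plantedMoment, plantedMoment,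
      Multiset.card_add, pow_add]
    ring
  · intro e he
    refine ⟨?_, ?_⟩
    · rintro ⟨f, hf, h | h⟩
      · exact hu e he ⟨f, hf, Or.inl (Sum.inl_injective h)⟩
      · cases h
    · rintro ⟨f, hf, h | h⟩
      · cases h
      · exact hu e he ⟨f, hf, Or.inr (Sum.inr_injective h)⟩

lemma abs_plantedCumulant_le [Finite R] [Finite C] [NeZero k] {lam : ℝ} (hlam : 0 ≤ lam)
    (e₀ : R × C) (s : Multiset (R × C)) :
    |plantedCumulant k lam e₀ s| ≤
      ((s.card : ℝ) + 1) ^ s.card * (lam ^ s.card * monoProb k (e₀ ::ₘ s)) := by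
  refine abs_cumulant_le (fun s => ?_) (fun s => ?_) (fun t u => ?_) s
  · exact mul_nonneg (pow_nonneg hlam _) (monoProb_nonneg _)
  · exact mul_nonneg (pow_nonneg hlam _) (monoProb_nonneg _)
  · have h := monoProb_mul_le (k := k) (e₀ ::ₘ t) u
    rw [Multiset.cons_add] at h
    rw [plantedMoment, Multiset.card_add, pow_add]
    calc _ = (lam ^ t.card * lam ^ u.card) * (monoProb k (e₀ ::ₘ t) * monoProb k u) := by ring
      _ ≤ _ := mul_le_mul_of_nonneg_left h (by positivity)

end Connected

/-! ### Counting connected edge sequences and the norm of the cumulants -/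

section Counting

variable {R C : Type*} [Fintype R] [Fintype C] {k : ℕ} [NeZero k]

/-- An edge with both end points already used has at most `s.card ^ 2` choices and does not increase
the probability. A touching edge with a new end point gains exactly `k⁻¹`, hence `k⁻²` after
squaring. -/
lemma sum_touches_le [DecidableEq R] [DecidableEq C] (s : Multiset (R × C))
    [DecidablePred fun e => Touches e s] :
    ∑ e, (if Touches e s then monoProb k (e ::ₘ s) ^ 2 else 0) ≤
      ((s.card : ℝ) ^ 2 + s.card * ((Fintype.card R + Fintype.card C : ℕ) : ℝ) / k ^ 2) *
        monoProb k s ^ 2 := by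
  set A : Finset R := (s.map Prod.fst).toFinset with hA
  set B : Finset C := (s.map Prod.snd).toFinset with hB
  have hAc : (A.card : ℝ) ≤ s.card := by
    exact_mod_cast (Multiset.toFinset_card_le _).trans (by simp)
  have hBc : (B.card : ℝ) ≤ s.card := by
    exact_mod_cast (Multiset.toFinset_card_le _).trans (by simp)
  set p := monoProb k s ^ 2 with hp
  have hp0 : 0 ≤ p := sq_nonneg _
  have hk : (0 : ℝ) < k := Nat.cast_pos.2 (NeZero.pos k)
  have hterm : ∀ e : R × C, (if Touches e s then monoProb k (e ::ₘ s) ^ 2 else 0) ≤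
      (if e ∈ A ×ˢ B then p else 0) + (if e ∈ A ×ˢ (Finset.univ : Finset C) then p / k ^ 2 else 0)
        + (if e ∈ (Finset.univ : Finset R) ×ˢ B then p / k ^ 2 else 0) := by
    intro e
    have hpk : 0 ≤ p / k ^ 2 := by positivity
    have hi : ∀ (P : Prop) [Decidable P] (x : ℝ), 0 ≤ x → 0 ≤ if P then x else 0 := by
      intro P _ x hx
      split_ifs <;> simp [hx]
    by_cases ht : Touches e s
    · rw [if_pos ht]
      by_cases hAB : e ∈ A ×ˢ B
      · rw [if_pos hAB]
        have : monoProb k (e ::ₘ s) ^ 2 ≤ p :=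
          pow_le_pow_left₀ (monoProb_nonneg _) (monoProb_anti (Multiset.le_cons_self _ _)) _
        have h2 := hi (e ∈ A ×ˢ (Finset.univ : Finset C)) _ hpk
        have h3 := hi (e ∈ (Finset.univ : Finset R) ×ˢ B) _ hpk
        linarith
      · have hnew : (∀ f ∈ s, e.1 ≠ f.1) ∨ ∀ f ∈ s, e.2 ≠ f.2 := by
          by_contra! h
          obtain ⟨⟨f, hf, hef⟩, ⟨g, hg, heg⟩⟩ := h
          refine hAB (Finset.mem_product.2 ⟨?_, ?_⟩)
          · rw [hA, Multiset.mem_toFinset, hef]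
            exact Multiset.mem_map_of_mem _ hf
          · rw [hB, Multiset.mem_toFinset, heg]
            exact Multiset.mem_map_of_mem _ hg
        have hv : monoProb k (e ::ₘ s) ^ 2 = p / k ^ 2 := by
          rw [monoProb_cons_of_new hnew, hp]
          field_simp
        rw [hv, if_neg hAB]
        obtain ⟨f, hf, h | h⟩ := ht
        · have : e ∈ A ×ˢ (Finset.univ : Finset C) := by
            refine Finset.mem_product.2 ⟨?_, Finset.mem_univ _⟩
            rw [hA, Multiset.mem_toFinset, h]
            exact Multiset.mem_map_of_mem _ hf
          rw [if_pos this]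
          have h3 := hi (e ∈ (Finset.univ : Finset R) ×ˢ B) _ hpk
          linarith
        · have : e ∈ (Finset.univ : Finset R) ×ˢ B := by
            refine Finset.mem_product.2 ⟨Finset.mem_univ _, ?_⟩
            rw [hB, Multiset.mem_toFinset, h]
            exact Multiset.mem_map_of_mem _ hf
          rw [if_pos this]
          have h3 := hi (e ∈ A ×ˢ (Finset.univ : Finset C)) _ hpk
          linarith
    · rw [if_neg ht]
      exact add_nonneg (add_nonneg (hi _ _ hp0) (hi _ _ hpk)) (hi _ _ hpk)
  refine (Finset.sum_le_sum fun e _ => hterm e).trans ?_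
  rw [Finset.sum_add_distrib, Finset.sum_add_distrib]
  simp only [Finset.sum_ite_mem, Finset.univ_inter, Finset.sum_const, Finset.card_product,
    nsmul_eq_mul, Finset.card_univ]
  push_cast
  have e1 : (A.card : ℝ) * B.card ≤ s.card ^ 2 := by
    rw [sq]
    exact mul_le_mul hAc hBc (by positivity) (by positivity)
  calc _ ≤ (s.card : ℝ) ^ 2 * p + s.card * Fintype.card C * (p / k ^ 2)
        + Fintype.card R * s.card * (p / k ^ 2) := by gcongr
    _ = _ := by ring

lemma coe_ofFn_eq_cons {α : Type*} {m : ℕ} (j : Fin (m + 1)) (a : α) (t : Fin m → α) :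
    ((List.ofFn (j.insertNth a t : Fin (m + 1) → α) : List α) : Multiset α) =
      a ::ₘ ((List.ofFn t : List α) : Multiset α) := by
  rw [← Fin.univ_val_map, ← Fin.univ_val_map, Fin.univ_succAbove m j]
  simp [Function.comp_def]

open Classical in
/-- The sum of squared moments over connected sequences of `m` edges. -/
noncomputable def connectedSum (k : ℕ) (e₀ : R × C) (m : ℕ) : ℝ :=
  tupleSum m fun l : List (R × C) =>
    if ConnectedTo e₀ (↑l : Multiset (R × C)) then monoProb k (e₀ ::ₘ (↑l : Multiset (R × C))) ^ 2
    else 0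

/-- A connected sequence has a last-added edge in the inductive construction, but it may sit at any
position of the tuple: the union over positions costs `m + 1`, and the remaining factor counts the
choices of that edge. -/
lemma connectedSum_succ_le (e₀ : R × C) (m : ℕ) :
    connectedSum k e₀ (m + 1) ≤ (m + 1) * (((m : ℝ) + 1) ^ 2 +
      ((m : ℝ) + 1) * ((Fintype.card R + Fintype.card C : ℕ) : ℝ) / k ^ 2) *
        connectedSum k e₀ m := by
  classical
  set K : ℝ := ((m : ℝ) + 1) ^ 2 +
      ((m : ℝ) + 1) * ((Fintype.card R + Fintype.card C : ℕ) : ℝ) / k ^ 2 with hK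
  let G : (R × C) → Multiset (R × C) → ℝ := fun e s =>
    if ConnectedTo e₀ s then if Touches e (e₀ ::ₘ s) then monoProb k (e ::ₘ e₀ ::ₘ s) ^ 2 else 0
    else 0
  have hG0 : ∀ e s, 0 ≤ G e s := fun e s => by
    simp only [G]
    split_ifs <;> positivity
  have h1 : ∀ t : Fin (m + 1) → R × C,
      (if ConnectedTo e₀ ((List.ofFn t : List _) : Multiset (R × C)) then
        monoProb k (e₀ ::ₘ ((List.ofFn t : List _) : Multiset (R × C))) ^ 2 else 0) ≤
      ∑ j : Fin (m + 1), G (t j) ((List.ofFn (j.removeNth t) : List _) : Multiset (R × C)) := by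
    intro t
    split_ifs with hc
    · obtain ⟨e, s, he, hs, hl⟩ : ∃ e s, Touches e (e₀ ::ₘ s) ∧ ConnectedTo e₀ s ∧
          ((List.ofFn t : List _) : Multiset (R × C)) = e ::ₘ s := by
        generalize hl : ((List.ofFn t : List _) : Multiset (R × C)) = l at hc
        cases hc with
        | zero => simp at hl
        | cons he hs => exact ⟨_, _, he, hs, rfl⟩
      have hmem : e ∈ List.ofFn t := by
        rw [← Multiset.mem_coe, hl]
        exact Multiset.mem_cons_self _ _
      obtain ⟨j, hj⟩ := (List.mem_ofFn' t e).1 hmem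
      have ht := coe_ofFn_eq_cons j (t j) (j.removeNth t)
      rw [Fin.insertNth_self_removeNth, hl, hj, Multiset.cons_inj_right] at ht
      refine le_trans (le_of_eq ?_) (Finset.single_le_sum (fun i _ => hG0 _ _) (Finset.mem_univ j))
      rw [hl, hj, ← ht]
      simp only [G]
      rw [if_pos hs, if_pos he, Multiset.cons_swap]
    · exact Finset.sum_nonneg fun j _ => hG0 _ _
  have h2 : ∀ j : Fin (m + 1), ∑ t : Fin (m + 1) → R × C,
      G (t j) ((List.ofFn (j.removeNth t) : List _) : Multiset (R × C)) =
      ∑ t : Fin m → R × C, ∑ e, G e ((List.ofFn t : List _) : Multiset (R × C)) := by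
    intro j
    rw [← (Fin.insertNthEquiv (fun _ : Fin (m + 1) => R × C) j).sum_comp,
      Fintype.sum_prod_type_right]
    simp [Fin.insertNthEquiv]
  have h3 : ∀ t : Fin m → R × C, ∑ e, G e ((List.ofFn t : List _) : Multiset (R × C)) ≤
      K * if ConnectedTo e₀ ((List.ofFn t : List _) : Multiset (R × C)) then
        monoProb k (e₀ ::ₘ ((List.ofFn t : List _) : Multiset (R × C))) ^ 2 else 0 := by
    intro t
    by_cases hc : ConnectedTo e₀ ((List.ofFn t : List _) : Multiset (R × C))
    · have := sum_touches_le (k := k) (e₀ ::ₘ ((List.ofFn t : List _) : Multiset (R × C)))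
      rw [Multiset.card_cons, Multiset.coe_card, List.length_ofFn, Nat.cast_add_one] at this
      simp only [G, if_pos hc]
      exact this
    · simp [G, hc]
  unfold connectedSum tupleSum
  refine (Finset.sum_le_sum fun t _ => h1 t).trans ?_
  rw [Finset.sum_comm, Finset.sum_congr rfl fun j _ => h2 j, Finset.sum_const, Finset.card_univ,
    Fintype.card_fin, nsmul_eq_mul, mul_assoc]
  push_cast
  refine mul_le_mul_of_nonneg_left ?_ (by positivity)
  rw [Finset.mul_sum]
  exact Finset.sum_le_sum fun t _ => h3 t

lemma connectedSum_le (e₀ : R × C) (D m : ℕ) (hm : m ≤ D) :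
    connectedSum k e₀ m ≤ (m.factorial : ℝ) *
      ((D : ℝ) ^ 2 * (1 + ((Fintype.card R + Fintype.card C : ℕ) : ℝ) / k ^ 2)) ^ m *
        ((k : ℝ)⁻¹) ^ 2 := by
  induction m with
  | zero =>
    have : ConnectedTo e₀ 0 := .zero
    simp [connectedSum, tupleSum_zero, this, monoProb_singleton]
  | succ m ih =>
    have hD : (m : ℝ) + 1 ≤ D := by exact_mod_cast hm
    set T : ℝ := ((Fintype.card R + Fintype.card C : ℕ) : ℝ) / k ^ 2 with hT
    have hT0 : 0 ≤ T := by positivity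
    have hm1 : (1 : ℝ) ≤ (m : ℝ) + 1 := by
      have : (0 : ℝ) ≤ m := Nat.cast_nonneg m
      linarith
    have hK : ((m : ℝ) + 1) ^ 2 +
        ((m : ℝ) + 1) * ((Fintype.card R + Fintype.card C : ℕ) : ℝ) / k ^ 2 ≤
        (D : ℝ) ^ 2 * (1 + T) := by
      rw [mul_div_assoc, ← hT, mul_add, mul_one]
      have h1 : ((m : ℝ) + 1) ^ 2 ≤ (D : ℝ) ^ 2 := pow_le_pow_left₀ (by positivity) hD 2
      -- The linear factor is weakened to `D ^ 2` so that both terms share one factor.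
      have h2 : (m : ℝ) + 1 ≤ (D : ℝ) ^ 2 := by nlinarith
      exact add_le_add h1 (mul_le_mul_of_nonneg_right h2 hT0)
    refine (connectedSum_succ_le e₀ m).trans ?_
    calc _ ≤ ((m : ℝ) + 1) * ((D : ℝ) ^ 2 * (1 + T)) * ((m.factorial : ℝ) *
          ((D : ℝ) ^ 2 * (1 + T)) ^ m * ((k : ℝ)⁻¹) ^ 2) := by
          refine mul_le_mul (mul_le_mul_of_nonneg_left hK (by positivity)) (ih (by omega)) ?_
            (by positivity)
          refine Finset.sum_nonneg fun t _ => ?_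
          dsimp only
          split_ifs
          · positivity
          · exact le_rfl
      _ = _ := by
          rw [Nat.factorial_succ]
          push_cast
          ring

/-- The norm of the low-degree dual certificate. -/
lemma sum_sq_plantedCumulant_le {lam : ℝ} (hlam : 0 ≤ lam) (e₀ : R × C) (D : ℕ) (hD : 1 ≤ D)
    (h : lam ^ 2 * (4 * (D : ℝ) ^ 4 *
      (1 + ((Fintype.card R + Fintype.card C : ℕ) : ℝ) / k ^ 2)) ≤ 1 / 3) :
    ∑ m ∈ Finset.range (D + 1), ((m.factorial : ℝ))⁻¹ *
      tupleSum m (fun l => plantedCumulant k lam e₀ (Multiset.ofList l) ^ 2) ≤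
      3 / 2 * ((k : ℝ)⁻¹) ^ 2 := by
  classical
  set T : ℝ := ((Fintype.card R + Fintype.card C : ℕ) : ℝ) / k ^ 2 with hT
  have hT0 : 0 ≤ T := by positivity
  set r : ℝ := lam ^ 2 * (4 * (D : ℝ) ^ 4 * (1 + T)) with hr
  have hr0 : 0 ≤ r := by positivity
  have hD1 : (1 : ℝ) ≤ D := by exact_mod_cast hD
  have hterm : ∀ m ∈ Finset.range (D + 1), ((m.factorial : ℝ))⁻¹ *
      tupleSum m (fun l => plantedCumulant k lam e₀ (Multiset.ofList l) ^ 2) ≤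
      r ^ m * ((k : ℝ)⁻¹) ^ 2 := by
    intro m hm
    have hmD : m ≤ D := by simpa [Nat.lt_succ_iff] using hm
    have hmD' : (m : ℝ) ≤ D := by exact_mod_cast hmD
    have h1 : tupleSum m (fun l => plantedCumulant k lam e₀ (Multiset.ofList l) ^ 2) ≤
        (4 * (D : ℝ) ^ 2 * lam ^ 2) ^ m * connectedSum k e₀ m := by
      rw [connectedSum, tupleSum, tupleSum, Finset.mul_sum]
      refine Finset.sum_le_sum fun t _ => ?_
      split_ifs with hc
      · have h2 := abs_plantedCumulant_le (k := k) hlam e₀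
          ((List.ofFn t : List _) : Multiset (R × C))
        rw [Multiset.coe_card, List.length_ofFn] at h2
        rw [← sq_abs]
        refine (pow_le_pow_left₀ (abs_nonneg _) h2 2).trans ?_
        rw [← mul_assoc, ← mul_pow, mul_pow, ← pow_mul, mul_comm m 2, pow_mul]
        refine mul_le_mul_of_nonneg_right (pow_le_pow_left₀ (by positivity) ?_ m) (by positivity)
        rw [mul_pow]
        refine mul_le_mul_of_nonneg_right ?_ (by positivity)
        -- Here `m + 1 ≤ 2 D`, which is the source of the factor `4 D²` at each order.
        nlinarith
      · rw [plantedCumulant_eq_zero lam e₀ _ hc]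
        simp
    calc _ ≤ ((m.factorial : ℝ))⁻¹ * ((4 * (D : ℝ) ^ 2 * lam ^ 2) ^ m *
          ((m.factorial : ℝ) * ((D : ℝ) ^ 2 * (1 + T)) ^ m * ((k : ℝ)⁻¹) ^ 2)) := by
          refine mul_le_mul_of_nonneg_left (h1.trans ?_) (by positivity)
          exact mul_le_mul_of_nonneg_left (connectedSum_le e₀ D m hmD) (by positivity)
      _ = ((4 * (D : ℝ) ^ 2 * lam ^ 2) * ((D : ℝ) ^ 2 * (1 + T))) ^ m * ((k : ℝ)⁻¹) ^ 2 := by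
          have : (m.factorial : ℝ) ≠ 0 := by positivity
          rw [mul_pow (4 * (D : ℝ) ^ 2 * lam ^ 2)]
          field_simp
      _ = _ := by
          rw [hr]
          ring
  refine (Finset.sum_le_sum hterm).trans ?_
  rw [← Finset.sum_mul]
  refine mul_le_mul_of_nonneg_right ?_ (by positivity)
  -- With `r ≤ 1/3` the geometric sum is at most `1 / (1 - 1/3) = 3/2`.
  have hgeom := mul_neg_geom_sum r (D + 1)
  have hS : 0 ≤ ∑ i ∈ Finset.range (D + 1), r ^ i := Finset.sum_nonneg fun i _ => pow_nonneg hr0 i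
  nlinarith [pow_nonneg hr0 (D + 1), mul_le_mul_of_nonneg_right h hS]

end Counting

end Biclustering

namespace Biclustering

open MvPolynomial

/-! ### Translations of polynomials -/

section Shift

variable {σ : Type*}

/-- Translation of a polynomial by a vector. -/
noncomputable def shift (x : σ → ℝ) : MvPolynomial σ ℝ →ₐ[ℝ] MvPolynomial σ ℝ :=
  aeval fun p => X p + C (x p)

lemma eval_shift (x y : σ → ℝ) (f : MvPolynomial σ ℝ) :
    eval y (shift x f) = eval (fun p => x p + y p) f := by
  induction f using MvPolynomial.induction_on with
  | C a => simp [shift]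
  | add p q hp hq => simp [hp, hq]
  | mul_X p n hp =>
    rw [map_mul, map_mul, hp, map_mul]
    simp [shift, add_comm]

lemma eval_shift_comm (x y : σ → ℝ) (f : MvPolynomial σ ℝ) :
    eval y (shift x f) = eval x (shift y f) := by
  simp only [eval_shift, add_comm]

lemma pderiv_shift (x : σ → ℝ) (j : σ) (f : MvPolynomial σ ℝ) :
    pderiv j (shift x f) = shift x (pderiv j f) := by
  classical
  induction f using MvPolynomial.induction_on with
  | C a => simp [shift]
  | add p q hp hq => simp [hp, hq]
  | mul_X p n hp =>
    have hX : shift x (X n : MvPolynomial σ ℝ) = X n + C (x n) := by simp [shift]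
    have hd : pderiv j (X n + C (x n) : MvPolynomial σ ℝ) = shift x (pderiv j (X n)) := by
      rw [map_add, pderiv_C, add_zero, pderiv_X, Pi.single_apply]
      split_ifs <;> simp
    rw [map_mul, pderiv_mul, pderiv_mul, hp, map_add, map_mul, map_mul, hX, hd]

lemma iterPderiv_shift (x : σ → ℝ) (l : List σ) (f : MvPolynomial σ ℝ) :
    iterPderiv l (shift x f) = shift x (iterPderiv l f) := by
  induction l generalizing f with
  | nil => rfl
  | cons j l ih => rw [iterPderiv, iterPderiv, pderiv_shift, ih]

lemma totalDegree_shift_le (x : σ → ℝ) (f : MvPolynomial σ ℝ) :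
    (shift x f).totalDegree ≤ f.totalDegree := by
  rw [shift, aeval_def, eval₂_eq]
  refine totalDegree_finsetSum_le fun s hs => ?_
  refine (totalDegree_mul _ _).trans ?_
  rw [algebraMap_eq, totalDegree_C, zero_add]
  refine (totalDegree_finsetProd _ _).trans (le_trans ?_ (le_totalDegree hs))
  rw [Finsupp.sum]
  refine Finset.sum_le_sum fun i _ => ?_
  refine (totalDegree_pow _ _).trans ?_
  refine (Nat.mul_le_mul_left _ ?_).trans (mul_one _).le
  refine (totalDegree_add _ _).trans ?_
  simp

lemma symbolOp_shift [Fintype σ] (N : ℕ) (κ : Multiset σ → ℝ) (x : σ → ℝ)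
    (f : MvPolynomial σ ℝ) : symbolOp N κ (shift x f) = shift x (symbolOp N κ f) := by
  simp [symbolOp, levelOp, tupleSum, iterPderiv_shift]

lemma symbolOp_sum_smul [Fintype σ] {Ω : Type*} (T : Finset Ω) (N : ℕ) (κ : Multiset σ → ℝ)
    (w : Ω → ℝ) (f : Ω → MvPolynomial σ ℝ) :
    symbolOp N κ (∑ z ∈ T, w z • f z) = ∑ z ∈ T, w z • symbolOp N κ (f z) := by
  classical
  induction T using Finset.induction_on with
  | empty => simpa using symbolOp_smul N κ 0 (0 : MvPolynomial σ ℝ)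
  | insert a T ha ih =>
    rw [Finset.sum_insert ha, Finset.sum_insert ha, symbolOp_add, symbolOp_smul, ih]

lemma gaussE_symbolOp [Fintype σ] (N : ℕ) (κ : Multiset σ → ℝ) (F : MvPolynomial σ ℝ) :
    gaussE (symbolOp N κ F) = ∑ m ∈ Finset.range N, ((m.factorial : ℝ))⁻¹ *
      tupleSum m fun l => κ l * gaussE (iterPderiv l F) := by
  simp [symbolOp, levelOp, tupleSum]

end Shift

/-! ### Average error of a low-degree polynomial under the planted prior -/

section LowDegree

variable {R C : Type*} [Fintype R] [Fintype C] [DecidableEq R] [DecidableEq C]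
  {k : ℕ} [NeZero k]

/-- The planted entries `lam * 1{z i = z j}`. -/
def planted (lam : ℝ) (z : R ⊕ C → ZMod k) (e : R × C) : ℝ :=
  if z (Sum.inl e.1) = z (Sum.inr e.2) then lam else 0

/-- The mass of a labeling under the uniform distribution. -/
noncomputable def labelWeight (R C : Type*) [Fintype R] [Fintype C] [DecidableEq R]
    [DecidableEq C] (k : ℕ) [NeZero k] : ℝ := ((Fintype.card (R ⊕ C → ZMod k) : ℝ))⁻¹

lemma labelWeight_nonneg : 0 ≤ labelWeight R C k := by
  unfold labelWeight
  positivity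

lemma sum_labelWeight : ∑ _z : R ⊕ C → ZMod k, labelWeight R C k = 1 := by
  rw [Finset.sum_const, Finset.card_univ, nsmul_eq_mul, labelWeight]
  exact mul_inv_cancel₀ (Nat.cast_ne_zero.2 Fintype.card_ne_zero)

omit [Fintype R] [Fintype C] [DecidableEq R] [DecidableEq C] [NeZero k] in
open Classical in
lemma prod_map_planted (lam : ℝ) (z : R ⊕ C → ZMod k) (s : Multiset (R × C)) :
    (s.map (planted lam z)).prod = lam ^ s.card * if z ∈ mono k s then 1 else 0 := by
  induction s using Multiset.induction_on with
  | empty => simp [mem_mono]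
  | cons e s ih =>
    rw [Multiset.map_cons, Multiset.prod_cons, ih, Multiset.card_cons, planted]
    have : z ∈ mono k (e ::ₘ s) ↔ z (Sum.inl e.1) = z (Sum.inr e.2) ∧ z ∈ mono k s := by
      simp [mem_mono]
    simp only [this]
    by_cases h1 : z (Sum.inl e.1) = z (Sum.inr e.2) <;> by_cases h2 : z ∈ mono k s <;>
      simp [h1, h2, pow_succ, mul_comm]

open Classical in
lemma sum_mono_indicator (s : Multiset (R × C)) :
    ∑ z : R ⊕ C → ZMod k, labelWeight R C k * (if z ∈ mono k s then 1 else 0) = monoProb k s := by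
  rw [← Finset.mul_sum, Finset.sum_boole, labelWeight, monoProb]
  have h1 := AddSubgroup.card_mul_index (mono (R := R) (C := C) k s)
  rw [Nat.card_eq_fintype_card, Nat.card_eq_fintype_card] at h1
  have h2 : (Finset.univ.filter fun z => z ∈ mono k s).card = Fintype.card (mono k s) :=
    (Fintype.card_subtype _).symm
  rw [h2, ← h1]
  have h3 : (Fintype.card (mono (R := R) (C := C) k s) : ℝ) ≠ 0 :=
    Nat.cast_ne_zero.2 Fintype.card_ne_zero
  push_cast
  field_simp

lemma plantedMoment_eq_mixedMoment (lam : ℝ) (s : Multiset (R × C)) :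
    plantedMoment k lam s = mixedMoment (fun _ => labelWeight R C k) (planted (k := k) lam) s := by
  classical
  simp only [mixedMoment, prod_map_planted, plantedMoment, mul_left_comm _ (lam ^ s.card)]
  rw [← Finset.mul_sum, sum_mono_indicator]

lemma weighted_plantedMoment_eq_mixedMoment (lam : ℝ) (e₀ : R × C) (s : Multiset (R × C)) :
    lam ^ s.card * monoProb k (e₀ ::ₘ s) =
      mixedMoment (fun z => labelWeight R C k * planted 1 z e₀) (planted (k := k) lam) s := by
  classical
  have h : ∀ z : R ⊕ C → ZMod k, labelWeight R C k * planted 1 z e₀ *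
      (lam ^ s.card * if z ∈ mono k s then 1 else 0) =
      lam ^ s.card * (labelWeight R C k * if z ∈ mono k (e₀ ::ₘ s) then 1 else 0) := by
    intro z
    have h1 := prod_map_planted 1 z (e₀ ::ₘ s)
    have h2 := prod_map_planted 1 z s
    rw [Multiset.map_cons, Multiset.prod_cons, one_pow, one_mul, h2, one_pow, one_mul] at h1
    rw [← h1]
    ring
  simp only [mixedMoment, prod_map_planted, h]
  rw [← Finset.mul_sum, sum_mono_indicator]

/-- The law of the observation, tested against `f`, as a mixture of translates. -/
noncomputable def mixtureShift (k : ℕ) [NeZero k] (lam : ℝ) (f : MvPolynomial (R × C) ℝ) :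
    MvPolynomial (R × C) ℝ :=
  ∑ z : R ⊕ C → ZMod k, labelWeight R C k • shift (planted lam z) f

/-- For fixed noise `y`, `f` at signal plus noise is the polynomial `shift y f` evaluated at the
signal, so the cumulant identity applies pointwise in `y`. The operator commutes with translations
and can therefore be applied to the mixture. -/
lemma sum_planted_gaussE_shift (lam : ℝ) (e₀ : R × C) (D : ℕ) (f : MvPolynomial (R × C) ℝ)
    (hf : f.totalDegree ≤ D) :
    ∑ z : R ⊕ C → ZMod k, labelWeight R C k * planted 1 z e₀ * gaussE (shift (planted lam z) f) =
      ∑ m ∈ Finset.range (D + 1), ((m.factorial : ℝ))⁻¹ *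
        tupleSum m fun l => plantedCumulant k lam e₀ (Multiset.ofList l) *
          gaussE (iterPderiv l (mixtureShift k lam f)) := by
  have hlin : ∑ z : R ⊕ C → ZMod k,
      labelWeight R C k * planted 1 z e₀ * gaussE (shift (planted lam z) f) =
      gaussE (∑ z : R ⊕ C → ZMod k,
        (labelWeight R C k * planted 1 z e₀) • shift (planted lam z) f) := by
    simp only [map_sum, LinearMap.map_smul, smul_eq_mul]
  rw [← gaussE_symbolOp, hlin, gaussE_apply, gaussE_apply]
  refine integral_congr_ae (ae_of_all _ fun y => ?_)
  dsimp only
  have h := sum_eval_eq_sum_eval_symbolOp (Ω := R ⊕ C → ZMod k) _ _ (planted (k := k) lam)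
    (weighted_plantedMoment_eq_mixedMoment lam e₀) (plantedMoment_eq_mixedMoment lam)
    (by simp [plantedMoment, monoProb_zero]) (D + 1) (shift y f)
    (Nat.lt_succ_of_le ((totalDegree_shift_le y f).trans hf))
  rw [mixtureShift, symbolOp_sum_smul]
  simp only [map_sum, smul_eval]
  calc _ = ∑ z : R ⊕ C → ZMod k, labelWeight R C k * planted 1 z e₀ *
        eval (planted lam z) (shift y f) := by
        refine Finset.sum_congr rfl fun z _ => ?_
        rw [eval_shift_comm]
    _ = _ := h
    _ = _ := by
        refine Finset.sum_congr rfl fun z _ => ?_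
        rw [symbolOp_shift, symbolOp_shift, eval_shift_comm]
        rfl

/-- Jensen's inequality, obtained by averaging `𝔼 (f_z - F)² ≥ 0` over `z`, where `f_z` is the
translate of `f` and `F` the mean of the translates. -/
lemma gaussE_mixtureShift_sq_le (lam : ℝ) (f : MvPolynomial (R × C) ℝ) :
    gaussE (mixtureShift k lam f * mixtureShift k lam f) ≤
      ∑ z : R ⊕ C → ZMod k, labelWeight R C k *
        gaussE (shift (planted lam z) f * shift (planted lam z) f) := by
  set F := mixtureShift k lam f with hF
  have h1 : ∀ z : R ⊕ C → ZMod k,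
      2 * (labelWeight R C k * gaussE (F * shift (planted lam z) f)) -
        labelWeight R C k * gaussE (F * F) ≤
      labelWeight R C k * gaussE (shift (planted lam z) f * shift (planted lam z) f) := by
    intro z
    have h := gaussE_sq_nonneg (shift (planted lam z) f - F)
    have e : (shift (planted lam z) f - F) * (shift (planted lam z) f - F) =
        shift (planted lam z) f * shift (planted lam z) f -
          (F * shift (planted lam z) f + F * shift (planted lam z) f) + F * F := by ring
    rw [e, map_add, map_sub, map_add] at h
    nlinarith [labelWeight_nonneg (R := R) (C := C) (k := k)]
  have h2 := Finset.sum_le_sum fun z (_ : z ∈ Finset.univ) => h1 z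
  rw [Finset.sum_sub_distrib, ← Finset.mul_sum, ← Finset.sum_mul, sum_labelWeight, one_mul] at h2
  have h3 : ∑ z : R ⊕ C → ZMod k, labelWeight R C k * gaussE (F * shift (planted lam z) f) =
      gaussE (F * F) := by
    calc _ = gaussE (F * ∑ z : R ⊕ C → ZMod k, labelWeight R C k • shift (planted lam z) f) := by
          rw [Finset.mul_sum, map_sum]
          refine Finset.sum_congr rfl fun z _ => ?_
          rw [mul_smul_comm, LinearMap.map_smul, smul_eq_mul]
      _ = _ := rfl
  rw [h3] at h2
  linarith

lemma sum_planted_one (e₀ : R × C) :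
    ∑ z : R ⊕ C → ZMod k, labelWeight R C k * planted 1 z e₀ = (k : ℝ)⁻¹ := by
  have h := weighted_plantedMoment_eq_mixedMoment (k := k) 1 e₀ 0
  simpa [mixedMoment, monoProb_singleton] using h.symm

/-- The average risk of a low-degree polynomial estimator of one entry. -/
lemma le_sum_gaussE_sq_sub (hk : 2 ≤ k) {lam : ℝ} (hlam : 0 ≤ lam) (e₀ : R × C) (D : ℕ)
    (hD : 1 ≤ D)
    (h : lam ^ 2 * (4 * (D : ℝ) ^ 4 *
      (1 + ((Fintype.card R + Fintype.card C : ℕ) : ℝ) / k ^ 2)) ≤ 1 / 3)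
    (f : MvPolynomial (R × C) ℝ) (hf : f.totalDegree ≤ D) :
    lam ^ 2 / (4 * k) ≤ ∑ z : R ⊕ C → ZMod k, labelWeight R C k *
      gaussE ((shift (planted lam z) f - MvPolynomial.C (planted lam z e₀)) ^ 2) := by
  set a := gaussE (mixtureShift k lam f * mixtureShift k lam f) with ha
  set c := ∑ z : R ⊕ C → ZMod k,
    labelWeight R C k * planted 1 z e₀ * gaussE (shift (planted lam z) f) with hc
  have ha0 : 0 ≤ a := gaussE_sq_nonneg _
  have hca : c ^ 2 ≤ 3 / 2 * ((k : ℝ)⁻¹) ^ 2 * a := by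
    rw [hc, sum_planted_gaussE_shift lam e₀ D f hf]
    refine (sq_sum_tupleSum_le (D + 1)
      (fun l => plantedCumulant k lam e₀ (Multiset.ofList l)) (mixtureShift k lam f)).trans ?_
    exact mul_le_mul_of_nonneg_right (sum_sq_plantedCumulant_le hlam e₀ D hD h) ha0
  have hx : ∀ z : R ⊕ C → ZMod k, labelWeight R C k *
      gaussE ((shift (planted lam z) f - MvPolynomial.C (planted lam z e₀)) ^ 2) =
      labelWeight R C k * gaussE (shift (planted lam z) f * shift (planted lam z) f) -
        2 * lam * (labelWeight R C k * planted 1 z e₀ * gaussE (shift (planted lam z) f)) +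
        lam ^ 2 * (labelWeight R C k * planted 1 z e₀) := by
    intro z
    have e : (shift (planted lam z) f - MvPolynomial.C (planted lam z e₀)) ^ 2 =
        shift (planted lam z) f * shift (planted lam z) f
          - (2 * planted lam z e₀) • shift (planted lam z) f
          + MvPolynomial.C (planted lam z e₀ ^ 2) := by
      rw [← C_mul', map_mul, map_pow, map_ofNat]
      ring
    rw [e, map_add, map_sub, map_smul, gaussE_C, smul_eq_mul]
    unfold planted
    split_ifs <;> ring
  rw [Finset.sum_congr rfl fun z _ => hx z, Finset.sum_add_distrib, Finset.sum_sub_distrib,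
    ← Finset.mul_sum Finset.univ _ (2 * lam), ← Finset.mul_sum Finset.univ _ (lam ^ 2),
    sum_planted_one, ← hc]
  have hJ := gaussE_mixtureShift_sq_le (k := k) lam f
  rw [← ha] at hJ
  have hk2 : (2 : ℝ) ≤ k := by exact_mod_cast hk
  have hki : (k : ℝ)⁻¹ ≤ 1 / 2 := by
    rw [inv_eq_one_div]
    exact one_div_le_one_div_of_le (by norm_num) hk2
  have hki0 : 0 ≤ (k : ℝ)⁻¹ := by positivity
  set q := (k : ℝ)⁻¹ with hq
  -- AM-GM in squared form: `(2 lam c)² ≤ 4 a b ≤ (a + b)²` with `b = lam² (3/2) q²`.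
  have h2c : 2 * lam * c ≤ a + lam ^ 2 * (3 / 2 * q ^ 2) := by
    refine le_of_sq_le_sq ?_ (by positivity)
    have h1 : (2 * lam * c) ^ 2 ≤ 4 * lam ^ 2 * (3 / 2 * q ^ 2 * a) := by
      rw [mul_pow, mul_pow]
      nlinarith [mul_le_mul_of_nonneg_left hca (sq_nonneg lam)]
    nlinarith [sq_nonneg (a - lam ^ 2 * (3 / 2 * q ^ 2))]
  -- The bound `q ≤ 1/2`, from `k ≥ 2`, leaves a quarter of the prior second moment `lam² q`.
  have hq2 : lam ^ 2 * (3 / 2 * q ^ 2) ≤ lam ^ 2 * (3 / 4 * q) :=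
    mul_le_mul_of_nonneg_left (by nlinarith) (sq_nonneg _)
  have hgoal : lam ^ 2 / (4 * k) = lam ^ 2 * (1 / 4 * q) := by
    rw [hq]
    field_simp
  rw [hgoal]
  linarith

end LowDegree

/-! ### From average risk to minimax risk -/

section Minimax

lemma planted_mem_paramSpace {n₁ n₂ k₁ k₂ k : ℕ} [NeZero k] (h₁ : k ≤ k₁) (h₂ : k ≤ k₂) (lam : ℝ)
    (z : Fin n₁ ⊕ Fin n₂ → ZMod k) :
    (fun i j => planted lam z (i, j) : Matrix (Fin n₁) (Fin n₂) ℝ) ∈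
      paramSpace n₁ n₂ k₁ k₂ := by
  refine ⟨fun a b => if a.val = b.val then lam else 0,
    fun i => ⟨(z (Sum.inl i)).val, (ZMod.val_lt _).trans_le h₁⟩,
    fun j => ⟨(z (Sum.inr j)).val, (ZMod.val_lt _).trans_le h₂⟩, fun i j => ?_⟩
  simp [planted, (ZMod.val_injective k).eq_iff]

variable {n₁ n₂ : ℕ}

lemma risk_eq (F : Matrix (Fin n₁) (Fin n₂) (MvPolynomial (Fin n₁ × Fin n₂) ℝ))
    (M : Matrix (Fin n₁) (Fin n₂) ℝ) :
    risk F M = ENNReal.ofReal (1 / ((n₁ : ℝ) * n₂) * ∑ i, ∑ j,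
      gaussE ((shift (fun p => M p.1 p.2) (F i j) - C (M i j)) ^ 2)) := by
  have hpoly : ∀ E : Fin n₁ × Fin n₂ → ℝ, loss (estimate F (observation M E)) M =
      eval E ((1 / ((n₁ : ℝ) * n₂)) • ∑ i, ∑ j,
        (shift (fun p => M p.1 p.2) (F i j) - C (M i j)) ^ 2) := by
    intro E
    simp only [loss, estimate, smul_eval, map_sum, map_pow, map_sub, eval_shift, eval_C]
    rfl
  simp only [risk, hpoly]
  rw [noiseLaw, ← ofReal_integral_eq_lintegral_ofReal (integrable_eval _)
    (ae_of_all _ fun E => ?_), ← gaussE_apply]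
  · simp
  · refine le_of_le_of_eq ?_ (hpoly E)
    unfold loss
    positivity

/-- The minimax risk dominates the average risk over planted block matrices. -/
lemma ofReal_le_polyMinimaxRisk {k₁ k₂ k D : ℕ} (hn₁ : 1 ≤ n₁) (hn₂ : 1 ≤ n₂) (h₁ : k ≤ k₁)
    (h₂ : k ≤ k₂) (hk : 2 ≤ k) (hD : 1 ≤ D) {lam : ℝ} (hlam : 0 ≤ lam)
    (h : lam ^ 2 * (4 * (D : ℝ) ^ 4 * (1 + ((n₁ : ℝ) + n₂) / k ^ 2)) ≤ 1 / 3) :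
    ENNReal.ofReal (lam ^ 2 / (4 * k)) ≤ polyMinimaxRisk n₁ n₂ k₁ k₂ D := by
  have : NeZero k := ⟨by omega⟩
  refine le_iInf₂ fun F hF => ?_
  set Ω := Fin n₁ ⊕ Fin n₂ → ZMod k
  let M : Ω → Matrix (Fin n₁) (Fin n₂) ℝ := fun z i j => planted lam z (i, j)
  let ρ : Ω → ℝ := fun z => 1 / ((n₁ : ℝ) * n₂) * ∑ i, ∑ j,
      gaussE ((shift (planted lam z) (F i j) - C (planted lam z (i, j))) ^ 2)
  have hρ : ∀ z, risk F (M z) = ENNReal.ofReal (ρ z) := fun z => risk_eq F (M z)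
  set w := labelWeight (Fin n₁) (Fin n₂) k
  have hn : ((n₁ : ℝ) * n₂) ≠ 0 := by positivity
  have havg : ∑ _z : Ω, w * (lam ^ 2 / (4 * k)) ≤ ∑ z : Ω, w * ρ z := by
    rw [← Finset.sum_mul, sum_labelWeight, one_mul]
    have hrw : ∑ z : Ω, w * ρ z = 1 / ((n₁ : ℝ) * n₂) * ∑ i, ∑ j, ∑ z : Ω, w *
        gaussE ((shift (planted lam z) (F i j) - C (planted lam z (i, j))) ^ 2) := by
      simp only [ρ, mul_left_comm w, ← Finset.mul_sum]
      congr 1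
      simp only [Finset.mul_sum]
      rw [Finset.sum_comm]
      refine Finset.sum_congr rfl fun i _ => ?_
      rw [Finset.sum_comm]
    rw [hrw]
    have hij : ∀ i j, lam ^ 2 / (4 * k) ≤ ∑ z : Ω, w *
        gaussE ((shift (planted lam z) (F i j) - C (planted lam z (i, j))) ^ 2) := fun i j =>
      le_sum_gaussE_sq_sub hk hlam (i, j) D hD (by simpa using h) (F i j) (hF i j)
    calc lam ^ 2 / (4 * k) = 1 / ((n₁ : ℝ) * n₂) * ∑ _i : Fin n₁, ∑ _j : Fin n₂,
          lam ^ 2 / (4 * k) := by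
          simp only [Finset.sum_const, Finset.card_univ, Fintype.card_fin, nsmul_eq_mul]
          field_simp
      _ ≤ _ := by
          refine mul_le_mul_of_nonneg_left ?_ (by positivity)
          exact Finset.sum_le_sum fun i _ => Finset.sum_le_sum fun j _ => hij i j
  -- Some labeling has risk at least the average; it is the witness for the supremum.
  obtain ⟨z, -, hz⟩ := Finset.exists_le_of_sum_le Finset.univ_nonempty havg
  have hw : 0 < w := inv_pos.2 (Nat.cast_pos.2 Fintype.card_pos)
  have hz' : lam ^ 2 / (4 * k) ≤ ρ z := le_of_mul_le_mul_left hz hw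
  refine le_iSup₂_of_le (M z) (planted_mem_paramSpace h₁ h₂ lam z) ?_
  rw [hρ]
  exact ENNReal.ofReal_le_ofReal hz'

end Minimax

end Biclustering

/-! ### Choice of the signal strength -/

theorem corollary2 :
    ∃ c : ℝ, 0 < c ∧
      ∀ (n₁ n₂ k₁ k₂ D : ℕ), 1 ≤ n₁ → 1 ≤ n₂ → 2 ≤ min k₁ k₂ → 1 ≤ D →
        ENNReal.ofReal
            (c / (D : ℝ) ^ 4 *
              min (((min k₁ k₂ : ℕ) : ℝ) / ((n₁ : ℝ) + n₂)) (1 / ((min k₁ k₂ : ℕ) : ℝ))) ≤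
          Biclustering.polyMinimaxRisk n₁ n₂ k₁ k₂ D := by
  -- The constant is `1 / (4 * 24)`: `lam² = μ / (24 D⁴)` inserted into `lam² / (4k)`.
  refine ⟨1 / 96, by norm_num, fun n₁ n₂ k₁ k₂ D hn₁ hn₂ hk hD => ?_⟩
  set k := min k₁ k₂ with hkdef
  have hk0 : (0 : ℝ) < k := Nat.cast_pos.2 (by omega)
  have hD0 : (0 : ℝ) < D := Nat.cast_pos.2 (by omega)
  have hN0 : (0 : ℝ) < (n₁ : ℝ) + n₂ := by
    have : (0 : ℝ) < n₁ := Nat.cast_pos.2 (by omega)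
    positivity
  set N : ℝ := (n₁ : ℝ) + n₂ with hN
  set μ : ℝ := min ((k : ℝ) ^ 2 / N) 1 with hμ
  have hμ0 : 0 ≤ μ := le_min (by positivity) zero_le_one
  have hlam : √(μ / (24 * (D : ℝ) ^ 4)) ^ 2 = μ / (24 * (D : ℝ) ^ 4) :=
    Real.sq_sqrt (by positivity)
  have hμN : μ * (N / k ^ 2) ≤ 1 := by
    calc μ * (N / k ^ 2) ≤ (k : ℝ) ^ 2 / N * (N / k ^ 2) :=
          mul_le_mul_of_nonneg_right (min_le_left _ _) (by positivity)
      _ = 1 := by field_simp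
  -- Both `μ` and `μ N / k²` are at most `1`, so `24` is what brings `4 (μ + μ N / k²)` down to
  -- `1/3`.
  have hcond : √(μ / (24 * (D : ℝ) ^ 4)) ^ 2 * (4 * (D : ℝ) ^ 4 * (1 + N / k ^ 2)) ≤ 1 / 3 := by
    rw [hlam]
    have e : μ / (24 * (D : ℝ) ^ 4) * (4 * (D : ℝ) ^ 4 * (1 + N / k ^ 2)) =
        (μ + μ * (N / k ^ 2)) / 6 := by
      field_simp
      ring
    rw [e]
    have : μ ≤ 1 := min_le_right _ _
    linarith
  refine le_trans (le_of_eq ?_) (Biclustering.ofReal_le_polyMinimaxRisk (k := k) hn₁ hn₂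
    (min_le_left k₁ k₂) (min_le_right k₁ k₂) hk hD (Real.sqrt_nonneg _) hcond)
  congr 1
  have hmin : min ((k : ℝ) / N) (1 / k) = μ / k := by
    rw [hμ, ← min_div_div_right hk0.le]
    congr 1
    field_simp
  rw [hlam, hmin]
  field_simp
  ring
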